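/- All algebras are over $\mathbb{C}$. Let $\mathbf{NAlg}$ be the category of unital normed algebras (submultiplicative norm, $\|1\|=1$) with contractive unital algebra homomorphisms, and $\mathbf{NAlg}^{\wedge}$ its full subcategory of Banach algebras. Let $\mathbf{OAlg}$ be the category of abstract unital operator algebras, i.e. unital algebras $A$ with $\|1\|=1$ carrying an operator space structure (norms on all $M_n(A)$ with $\|v\oplus w\|=\max(\|v\|,\|w\|)$ and $\|\alpha v\beta\|\le\|\alpha\|\,\|v\|\,\|\beta\|$ for scalar matrices $\alpha,\beta$) such that $\|ab\|\le\|a\|\,\|b\|$ in every $M_n(A)$; its morphisms are the completely contractive unital algebra homomorphisms. Let $\mathbf{OAlg}^{\wedge}$ be its full subcategory of complete objects. Let $U:\mathbf{OAlg}\to\mathbf{NAlg}$ and $U^{\wedge}:\mathbf{OAlg}^{\wedge}\to\mathbf{NAlg}^{\wedge}$ be the forgetful functors. Both $U$ and $U^{\wedge}$ preserve coequalizers, but neither preserves all binary coproducts; in particular neither is a left adjoint. In both cases the coproduct of two copies of $C(\mathbb{D})$ exists and is not preserved, where $\mathbb{D}\subset\mathbb{C}$ is the closed unit disk and $C(X)$,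 for compact $X$, has the matrix norms $\|[f_{ij}]\|=\sup_{x}\|[f_{ij}(x)]\|$. More precisely, in the complete case the coproducts $C(\mathbb{D})\sqcup C(\mathbb{D})$ exist in both $\mathbf{NAlg}^{\wedge}$ and $\mathbf{OAlg}^{\wedge}$, and the canonical comparison morphism $$c:\ C(\mathbb{D})\sqcup^{\mathbf{NAlg}^{\wedge}}C(\mathbb{D})\longrightarrow U^{\wedge}\big(C(\mathbb{D})\sqcup^{\mathbf{OAlg}^{\wedge}}C(\mathbb{D})\big)$$ is not surjective. Call a morphism from $A$ to a commutative algebra an abelianization of $A$ if every morphism from $A$ to a commutative algebra of the category factors uniquely through it. Then: 1. The abelianization in $\mathbf{NAlg}^{\wedge}$ of the domain of $c$ is the completed projective tensor product $C(\mathbb{D})\widehat{\otimes}_{\pi}C(\mathbb{D})$, the two copies of $C(\mathbb{D})$ mapping to it by $f\mapsto f\otimes 1$ and $f\mapsto 1\otimes f$. 2. The abelianization of $C(\mathbb{D})\sqcup^{\mathbf{OAlg}^{\wedge}}C(\mathbb{D})$, both in $\mathbf{OAlg}^{\wedge}$ and (after applying $U^{\wedge}$) in $\mathbf{NAlg}^{\wedge}$,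 is $C(\mathbb{D}\times\mathbb{D})$, the two copies of $C(\mathbb{D})$ mapping to it by composition with the two projections. 3. The morphism that $c$ induces on abelianizations is the canonical morphism $C(\mathbb{D})\widehat{\otimes}_{\pi}C(\mathbb{D})\to C(\mathbb{D}\times\mathbb{D})$, $f\otimes g\mapsto\big((x,y)\mapsto f(x)g(y)\big)$, and it is not surjective. -/

import Mathlib

open CategoryTheory CategoryTheory.Limits
open scoped TensorProduct

universe u

noncomputable section

/-! ### Operator spaces and operator algebras -/

section OperatorAlgebras

open scoped Matrix.Norms.L2Operator

/-- An (abstract) operator space structure on a complex normed space `V`: a sequence of norms on the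
matrix spaces `M_n(V)`, given on `M_1(V)` by the norm of `V`, with
`‖v ⊕ w‖ = max ‖v‖ ‖w‖` and `‖α v β‖ ≤ ‖α‖ ‖v‖ ‖β‖` for rectangular scalar matrices `α`, `β`
(normed as operators between Euclidean spaces). -/
class OperatorSpace (V : Type u) [NormedAddCommGroup V] [NormedSpace ℂ V] where
  mnorm : ∀ n : ℕ, Seminorm ℂ (Matrix (Fin n) (Fin n) V)
  eq_zero_of_mnorm : ∀ (n : ℕ) (v : Matrix (Fin n) (Fin n) V), mnorm n v = 0 → v = 0
  mnorm_one : ∀ v : Matrix (Fin 1) (Fin 1) V, mnorm 1 v = ‖v 0 0‖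
  mnorm_directSum : ∀ (m n : ℕ) (v : Matrix (Fin m) (Fin m) V) (w : Matrix (Fin n) (Fin n) V),
    mnorm (m + n) (Matrix.reindex finSumFinEquiv finSumFinEquiv (Matrix.fromBlocks v 0 0 w)) =
      max (mnorm m v) (mnorm n w)
  mnorm_compress : ∀ (m n : ℕ) (α : Matrix (Fin n) (Fin m) ℂ) (v : Matrix (Fin m) (Fin m) V)
    (β : Matrix (Fin m) (Fin n) ℂ),
    mnorm n (Matrix.of fun i j => ∑ k, ∑ l, (α i k * β l j) • v k l) ≤ ‖α‖ * mnorm m v * ‖β‖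

/-- An (abstract) operator algebra structure on a normed algebra: an operator space structure for
which the multiplication is completely contractive, i.e. `‖a b‖ ≤ ‖a‖ ‖b‖` in every `M_n(A)`. -/
class OperatorAlgebra (A : Type u) [NormedRing A] [NormedAlgebra ℂ A] extends
    OperatorSpace A where
  mnorm_mul_le : ∀ (n : ℕ) (a b : Matrix (Fin n) (Fin n) A),
    mnorm n (a * b) ≤ mnorm n a * mnorm n b

/-- The supremum norm on `M_n(C(X))`. -/
def supMatrixNorm (X : Type u) [TopologicalSpace X] (n : ℕ) (F : Matrix (Fin n) (Fin n) C(X, ℂ)) :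
    ℝ :=
  ⨆ x : X, ‖F.map fun f => f x‖

lemma supMatrixNorm_bdd (X : Type u) [TopologicalSpace X] [CompactSpace X] (n : ℕ)
    (F : Matrix (Fin n) (Fin n) C(X, ℂ)) :
    BddAbove (Set.range fun x : X => ‖F.map fun f => f x‖) := by
  have hc : Continuous fun x : X => F.map fun f => f x := by
    refine continuous_pi fun i => continuous_pi fun j => ?_
    exact (F i j).continuous
  exact (isCompact_range hc.norm).bddAbove

lemma le_supMatrixNorm (X : Type u) [TopologicalSpace X] [CompactSpace X] (n : ℕ)
    (F : Matrix (Fin n) (Fin n) C(X, ℂ)) (x : X) :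
    ‖F.map fun f => f x‖ ≤ supMatrixNorm X n F :=
  le_ciSup (supMatrixNorm_bdd X n F) x

lemma supMatrixNorm_nonneg (X : Type u) [TopologicalSpace X] (n : ℕ)
    (F : Matrix (Fin n) (Fin n) C(X, ℂ)) : 0 ≤ supMatrixNorm X n F :=
  Real.iSup_nonneg fun _ => norm_nonneg _

lemma supMatrixNorm_le (X : Type u) [TopologicalSpace X] (n : ℕ)
    (F : Matrix (Fin n) (Fin n) C(X, ℂ)) {M : ℝ} (hM : 0 ≤ M)
    (h : ∀ x, ‖F.map fun f => f x‖ ≤ M) : supMatrixNorm X n F ≤ M :=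
  Real.iSup_le h hM

lemma l2_opNorm_le_of_sq {m n : ℕ} (M : Matrix (Fin m) (Fin n) ℂ) {c : ℝ} (hc : 0 ≤ c)
    (h : ∀ x : Fin n → ℂ, ∑ i, ‖(M.mulVec x) i‖ ^ 2 ≤ c ^ 2 * ∑ j, ‖x j‖ ^ 2) : ‖M‖ ≤ c := by
  rw [Matrix.l2_opNorm_def]
  refine ContinuousLinearMap.opNorm_le_bound _ hc fun x => ?_
  refine le_of_sq_le_sq ?_ (by positivity)
  rw [mul_pow, EuclideanSpace.norm_sq_eq, EuclideanSpace.norm_sq_eq]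
  exact h x

lemma sum_sq_mulVec_le {m n : ℕ} (M : Matrix (Fin m) (Fin n) ℂ) (x : Fin n → ℂ) :
    ∑ i, ‖(M.mulVec x) i‖ ^ 2 ≤ ‖M‖ ^ 2 * ∑ j, ‖x j‖ ^ 2 := by
  have h := Matrix.l2_opNorm_mulVec M (WithLp.toLp 2 x)
  have h2 := pow_le_pow_left₀ (norm_nonneg _) h 2
  rwa [mul_pow, EuclideanSpace.norm_sq_eq, EuclideanSpace.norm_sq_eq] at h2

lemma l2_opNorm_directSum {m n : ℕ} (v : Matrix (Fin m) (Fin m) ℂ) (w : Matrix (Fin n) (Fin n) ℂ) :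
    ‖Matrix.reindex finSumFinEquiv finSumFinEquiv (Matrix.fromBlocks v 0 0 w)‖ =
      max ‖v‖ ‖w‖ := by
  set M := Matrix.reindex finSumFinEquiv finSumFinEquiv (Matrix.fromBlocks v 0 0 w) with hM
  have key : ∀ x : Fin (m + n) → ℂ, ∑ i, ‖(M.mulVec x) i‖ ^ 2 =
      ∑ i, ‖(v.mulVec fun k => x (Fin.castAdd n k)) i‖ ^ 2 +
      ∑ i, ‖(w.mulVec fun k => x (Fin.natAdd m k)) i‖ ^ 2 := by
    intro x
    rw [Fin.sum_univ_add]
    congr 1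
    · refine Finset.sum_congr rfl fun i _ => ?_
      simp [hM, Matrix.mulVec, dotProduct, Fin.sum_univ_add]
    · refine Finset.sum_congr rfl fun i _ => ?_
      simp [hM, Matrix.mulVec, dotProduct, Fin.sum_univ_add]
  apply le_antisymm
  · refine l2_opNorm_le_of_sq M (le_max_of_le_left (norm_nonneg _)) fun x => ?_
    rw [key, Fin.sum_univ_add, mul_add]
    refine add_le_add ?_ ?_
    · refine (sum_sq_mulVec_le v _).trans ?_
      gcongr
      exact le_max_left _ _
    · refine (sum_sq_mulVec_le w _).trans ?_
      gcongr
      exact le_max_right _ _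
  · refine max_le ?_ ?_
    · refine l2_opNorm_le_of_sq v (norm_nonneg _) fun x => ?_
      have h := sum_sq_mulVec_le M (Fin.append x 0)
      rw [key] at h
      simp only [Fin.append_left, Fin.append_right, Fin.sum_univ_add] at h
      simpa using le_trans (le_add_of_nonneg_right (by positivity)) h
    · refine l2_opNorm_le_of_sq w (norm_nonneg _) fun x => ?_
      have h := sum_sq_mulVec_le M (Fin.append 0 x)
      rw [key] at h
      simp only [Fin.append_left, Fin.append_right, Fin.sum_univ_add] at h
      simpa using le_trans (le_add_of_nonneg_left (by positivity)) h

lemma l2_opNorm_fin_one (M : Matrix (Fin 1) (Fin 1) ℂ) : ‖M‖ = ‖M 0 0‖ := by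
  have : M = Matrix.diagonal fun i => M i i := by
    ext i j
    fin_cases i; fin_cases j
    simp
  rw [this, Matrix.l2_opNorm_diagonal]
  simp [Pi.norm_def]

/-- `supMatrixNorm` as a seminorm. -/
def supMatrixSeminorm (X : Type u) [TopologicalSpace X] [CompactSpace X] (n : ℕ) :
    Seminorm ℂ (Matrix (Fin n) (Fin n) C(X, ℂ)) :=
  Seminorm.ofSMulLE (supMatrixNorm X n)
    (le_antisymm (supMatrixNorm_le X n 0 le_rfl fun x => by
      rw [Matrix.map_zero _ (by simp), norm_zero]) (supMatrixNorm_nonneg X n 0))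
    (fun F G => supMatrixNorm_le X n _
      (add_nonneg (supMatrixNorm_nonneg X n F) (supMatrixNorm_nonneg X n G)) fun x => by
        rw [Matrix.map_add _ (by simp)]
        exact (norm_add_le _ _).trans
          (add_le_add (le_supMatrixNorm X n F x) (le_supMatrixNorm X n G x)))
    (fun r F => supMatrixNorm_le X n _
      (mul_nonneg (norm_nonneg r) (supMatrixNorm_nonneg X n F)) fun x => by
        have : ((r • F).map fun f => f x) = r • F.map fun f => f x := by
          ext i j; simp
        rw [this, norm_smul]
        exact mul_le_mul_of_nonneg_left (le_supMatrixNorm X n F x) (norm_nonneg r))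

lemma supMatrixSeminorm_apply (X : Type u) [TopologicalSpace X] [CompactSpace X] (n : ℕ)
    (F : Matrix (Fin n) (Fin n) C(X, ℂ)) : supMatrixSeminorm X n F = supMatrixNorm X n F := rfl

lemma supMatrixNorm_eq_zero (X : Type u) [TopologicalSpace X] [CompactSpace X] (n : ℕ)
    (F : Matrix (Fin n) (Fin n) C(X, ℂ)) (h : supMatrixNorm X n F = 0) : F = 0 := by
  ext i j x
  have h1 : ‖F.map fun f => f x‖ = 0 :=
    le_antisymm (h ▸ le_supMatrixNorm X n F x) (norm_nonneg _)
  have h2 := norm_eq_zero.1 h1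
  simpa using congrArg (fun M : Matrix (Fin n) (Fin n) ℂ => M i j) h2

lemma supMatrixNorm_one (X : Type u) [TopologicalSpace X] [CompactSpace X]
    (F : Matrix (Fin 1) (Fin 1) C(X, ℂ)) : supMatrixNorm X 1 F = ‖F 0 0‖ := by
  rw [ContinuousMap.norm_eq_iSup_norm]
  exact iSup_congr fun x => by rw [l2_opNorm_fin_one]; rfl

lemma supMatrixNorm_directSum (X : Type u) [TopologicalSpace X] [CompactSpace X] (m n : ℕ)
    (F : Matrix (Fin m) (Fin m) C(X, ℂ)) (G : Matrix (Fin n) (Fin n) C(X, ℂ)) :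
    supMatrixNorm X (m + n)
        (Matrix.reindex finSumFinEquiv finSumFinEquiv (Matrix.fromBlocks F 0 0 G)) =
      max (supMatrixNorm X m F) (supMatrixNorm X n G) := by
  have key : ∀ x, ‖(Matrix.reindex finSumFinEquiv finSumFinEquiv
      (Matrix.fromBlocks F 0 0 G)).map fun f => f x‖ =
      max ‖F.map fun f => f x‖ ‖G.map fun f => f x‖ := by
    intro x
    rw [← l2_opNorm_directSum]
    congr 1
    simp only [Matrix.reindex_apply, ← Matrix.submatrix_map, Matrix.fromBlocks_map]
    congr 2
  apply le_antisymm
  · refine supMatrixNorm_le X _ _ (le_max_of_le_left (supMatrixNorm_nonneg X m F)) fun x => ?_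
    rw [key]
    exact max_le_max (le_supMatrixNorm X m F x) (le_supMatrixNorm X n G x)
  · refine max_le (supMatrixNorm_le X _ _ (supMatrixNorm_nonneg X _ _) fun x => ?_)
      (supMatrixNorm_le X _ _ (supMatrixNorm_nonneg X _ _) fun x => ?_)
    · exact (le_max_left _ _).trans ((key x).symm.le.trans (le_supMatrixNorm X _ _ x))
    · exact (le_max_right _ _).trans ((key x).symm.le.trans (le_supMatrixNorm X _ _ x))

lemma supMatrixNorm_compress (X : Type u) [TopologicalSpace X] [CompactSpace X] (m n : ℕ)
    (α : Matrix (Fin n) (Fin m) ℂ) (F : Matrix (Fin m) (Fin m) C(X, ℂ))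
    (β : Matrix (Fin m) (Fin n) ℂ) :
    supMatrixNorm X n (Matrix.of fun i j => ∑ k, ∑ l, (α i k * β l j) • F k l) ≤
      ‖α‖ * supMatrixNorm X m F * ‖β‖ := by
  have h0 := supMatrixNorm_nonneg X m F
  refine supMatrixNorm_le X n _ (by positivity) fun x => ?_
  have : ((Matrix.of fun i j => ∑ k, ∑ l, (α i k * β l j) • F k l).map fun f => f x) =
      α * (F.map fun f => f x) * β := by
    ext i j
    simp only [Matrix.map_apply, Matrix.of_apply, Matrix.mul_apply, Finset.sum_mul]
    rw [Finset.sum_comm]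
    simp only [ContinuousMap.coe_sum, Finset.sum_apply, ContinuousMap.coe_smul, Pi.smul_apply,
      smul_eq_mul]
    exact Finset.sum_congr rfl fun k _ => Finset.sum_congr rfl fun l _ => by ring
  rw [this]
  refine (Matrix.l2_opNorm_mul _ _).trans ?_
  gcongr
  refine (Matrix.l2_opNorm_mul _ _).trans ?_
  gcongr
  exact le_supMatrixNorm X m F x

lemma supMatrixNorm_mul_le (X : Type u) [TopologicalSpace X] [CompactSpace X] (n : ℕ)
    (F G : Matrix (Fin n) (Fin n) C(X, ℂ)) :
    supMatrixNorm X n (F * G) ≤ supMatrixNorm X n F * supMatrixNorm X n G := by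
  have h0 := supMatrixNorm_nonneg X n F
  have h1 := supMatrixNorm_nonneg X n G
  refine supMatrixNorm_le X n _ (by positivity) fun x => ?_
  have : ((F * G).map fun f => f x) = (F.map fun f => f x) * (G.map fun f => f x) := by
    ext i j
    simp [Matrix.mul_apply]
  rw [this]
  refine (Matrix.l2_opNorm_mul _ _).trans ?_
  gcongr
  · exact le_supMatrixNorm X n F x
  · exact le_supMatrixNorm X n G x

/-- `C(X)`, for `X` compact, as an operator algebra with the supremum norms on matrices. -/
instance instOperatorAlgebraContinuousMap (X : Type u) [TopologicalSpace X] [CompactSpace X] :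
    OperatorAlgebra C(X, ℂ) where
  mnorm := supMatrixSeminorm X
  eq_zero_of_mnorm := supMatrixNorm_eq_zero X
  mnorm_one := supMatrixNorm_one X
  mnorm_directSum := supMatrixNorm_directSum X
  mnorm_compress := supMatrixNorm_compress X
  mnorm_mul_le := supMatrixNorm_mul_le X

end OperatorAlgebras

/-! ### The projective tensor product of commutative normed algebras -/

section ProjectiveTensor

variable (A B : Type u) [NormedCommRing A] [NormedAlgebra ℂ A] [NormedCommRing B]
  [NormedAlgebra ℂ B]

/-- The algebraic tensor product of two commutative normed algebras, to be normed by the projective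
norm. -/
def ProjTensor : Type u := A ⊗[ℂ] B

instance : CommRing (ProjTensor A B) := inferInstanceAs (CommRing (A ⊗[ℂ] B))

instance : Algebra ℂ (ProjTensor A B) := inferInstanceAs (Algebra ℂ (A ⊗[ℂ] B))

variable {A B}

/-- The elementary tensor `a ⊗ b`. -/
def ProjTensor.tmul (a : A) (b : B) : ProjTensor A B := a ⊗ₜ[ℂ] b

/-- The values `∑ ‖aᵢ‖ ‖bᵢ‖` over all finite representations `t = ∑ aᵢ ⊗ bᵢ`. -/
def ProjTensor.costs (t : ProjTensor A B) : Set ℝ :=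
  {r | ∃ l : List (A × B), (l.map fun p => ProjTensor.tmul p.1 p.2).sum = t ∧
    (l.map fun p => ‖p.1‖ * ‖p.2‖).sum = r}

/-- The projective norm: the infimum of `∑ ‖aᵢ‖ ‖bᵢ‖` over all `t = ∑ aᵢ ⊗ bᵢ`. -/
def ProjTensor.projNorm (t : ProjTensor A B) : ℝ := sInf (ProjTensor.costs t)

namespace ProjTensor

lemma costs_nonneg {t : ProjTensor A B} {r : ℝ} (hr : r ∈ costs t) : 0 ≤ r := by
  obtain ⟨l, -, rfl⟩ := hr
  refine List.sum_nonneg fun x hx => ?_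
  obtain ⟨p, -, rfl⟩ := List.mem_map.1 hx
  positivity

lemma costs_add {s t : ProjTensor A B} {q r : ℝ} (hq : q ∈ costs s) (hr : r ∈ costs t) :
    q + r ∈ costs (s + t) := by
  obtain ⟨l, rfl, rfl⟩ := hq
  obtain ⟨k, rfl, rfl⟩ := hr
  exact ⟨l ++ k, by simp, by simp⟩

lemma costs_tmul (a : A) (b : B) : ‖a‖ * ‖b‖ ∈ costs (tmul a b) := ⟨[(a, b)], by simp, by simp⟩

lemma costs_zero : (0 : ℝ) ∈ costs (0 : ProjTensor A B) := ⟨[], by simp, by simp⟩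

lemma costs_nonempty (t : ProjTensor A B) : (costs t).Nonempty := by
  induction t using TensorProduct.induction_on with
  | zero => exact ⟨0, costs_zero⟩
  | tmul a b => exact ⟨_, costs_tmul a b⟩
  | add s t hs ht =>
    obtain ⟨q, hq⟩ := hs
    obtain ⟨r, hr⟩ := ht
    exact ⟨_, costs_add hq hr⟩

lemma costs_smul (c : ℂ) {t : ProjTensor A B} {r : ℝ} (hr : r ∈ costs t) :
    ‖c‖ * r ∈ costs (c • t) := by
  obtain ⟨l, rfl, rfl⟩ := hr
  induction l with
  | nil => simpa using costs_zero
  | cons p l ih =>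
    simp only [List.map_cons, List.sum_cons, smul_add, mul_add]
    refine costs_add ?_ ih
    have h := costs_tmul (c • p.1) p.2
    rw [norm_smul, mul_assoc] at h
    exact h

lemma costs_tmul_mul (a : A) (b : B) {t : ProjTensor A B} {r : ℝ} (hr : r ∈ costs t) :
    ∃ q ∈ costs (tmul a b * t), q ≤ ‖a‖ * ‖b‖ * r := by
  obtain ⟨l, rfl, rfl⟩ := hr
  induction l with
  | nil => exact ⟨0, by simpa using costs_zero, by simp⟩
  | cons p l ih =>
    obtain ⟨q, hq, hq'⟩ := ih
    simp only [List.map_cons, List.sum_cons, mul_add]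
    have h : ‖a * p.1‖ * ‖b * p.2‖ ∈ costs (tmul a b * tmul p.1 p.2) := by
      have := costs_tmul (a * p.1) (b * p.2)
      have e : tmul a b * tmul p.1 p.2 = tmul (a * p.1) (b * p.2) :=
        Algebra.TensorProduct.tmul_mul_tmul a p.1 b p.2
      rwa [e]
    refine ⟨_, costs_add h hq, add_le_add ?_ hq'⟩
    calc ‖a * p.1‖ * ‖b * p.2‖ ≤ (‖a‖ * ‖p.1‖) * (‖b‖ * ‖p.2‖) := by
          gcongr <;> exact norm_mul_le _ _
      _ = ‖a‖ * ‖b‖ * (‖p.1‖ * ‖p.2‖) := by ring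

lemma costs_mul {s t : ProjTensor A B} {q r : ℝ} (hq : q ∈ costs s) (hr : r ∈ costs t) :
    ∃ c ∈ costs (s * t), c ≤ q * r := by
  obtain ⟨l, rfl, rfl⟩ := hq
  induction l with
  | nil => exact ⟨0, by simpa using costs_zero, by simp⟩
  | cons p l ih =>
    obtain ⟨c, hc, hc'⟩ := ih
    obtain ⟨d, hd, hd'⟩ := costs_tmul_mul p.1 p.2 hr
    simp only [List.map_cons, List.sum_cons, add_mul]
    exact ⟨_, costs_add hd hc, add_le_add hd' hc'⟩

lemma projNorm_le {t : ProjTensor A B} {r : ℝ} (hr : r ∈ costs t) : projNorm t ≤ r :=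
  csInf_le ⟨0, fun _ h => costs_nonneg h⟩ hr

lemma projNorm_nonneg (t : ProjTensor A B) : 0 ≤ projNorm t :=
  Real.sInf_nonneg fun _ h => costs_nonneg h

lemma exists_cost_lt (t : ProjTensor A B) {ε : ℝ} (hε : 0 < ε) :
    ∃ r ∈ costs t, r < projNorm t + ε :=
  exists_lt_of_csInf_lt (costs_nonempty t) (lt_add_of_pos_right _ hε)

lemma projNorm_add_le (s t : ProjTensor A B) : projNorm (s + t) ≤ projNorm s + projNorm t := by
  refine le_of_forall_pos_le_add fun ε hε => ?_
  obtain ⟨q, hq, hq'⟩ := exists_cost_lt s (half_pos hε)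
  obtain ⟨r, hr, hr'⟩ := exists_cost_lt t (half_pos hε)
  have := projNorm_le (costs_add hq hr)
  linarith

lemma projNorm_smul_le (c : ℂ) (t : ProjTensor A B) : projNorm (c • t) ≤ ‖c‖ * projNorm t := by
  refine le_of_forall_pos_le_add fun ε hε => ?_
  obtain ⟨r, hr, hr'⟩ := exists_cost_lt t (ε := ε / (‖c‖ + 1)) (by positivity)
  have h1 := projNorm_le (costs_smul c hr)
  have h2 : ‖c‖ * r ≤ ‖c‖ * (projNorm t + ε / (‖c‖ + 1)) := by gcongr
  have h3 : ‖c‖ * (ε / (‖c‖ + 1)) ≤ ε := by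
    rw [mul_div_assoc', div_le_iff₀ (by positivity)]
    nlinarith [norm_nonneg c]
  linarith [mul_add ‖c‖ (projNorm t) (ε / (‖c‖ + 1))]

lemma projNorm_mul_le (s t : ProjTensor A B) : projNorm (s * t) ≤ projNorm s * projNorm t := by
  have h1 : ∀ q ∈ costs s, ∀ r ∈ costs t, projNorm (s * t) ≤ q * r := fun q hq r hr => by
    obtain ⟨c, hc, hc'⟩ := costs_mul hq hr
    exact (projNorm_le hc).trans hc'
  have hlim : ∀ ε > 0, projNorm (s * t) ≤ (projNorm s + ε) * (projNorm t + ε) := fun ε hε => by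
    obtain ⟨q, hq, hq'⟩ := exists_cost_lt s hε
    obtain ⟨r, hr, hr'⟩ := exists_cost_lt t hε
    refine (h1 q hq r hr).trans ?_
    exact mul_le_mul hq'.le hr'.le (costs_nonneg hr) (add_nonneg (projNorm_nonneg s) hε.le)
  have hcont : Filter.Tendsto (fun ε : ℝ => (projNorm s + ε) * (projNorm t + ε))
      (nhdsWithin 0 (Set.Ioi 0)) (nhds ((projNorm s + 0) * (projNorm t + 0))) :=
    (Continuous.tendsto (by fun_prop) 0).mono_left nhdsWithin_le_nhds
  rw [add_zero, add_zero] at hcont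
  exact ge_of_tendsto hcont (by filter_upwards [self_mem_nhdsWithin] with ε hε using hlim ε hε)

lemma projNorm_zero : projNorm (0 : ProjTensor A B) = 0 :=
  le_antisymm (projNorm_le costs_zero) (projNorm_nonneg _)

/-- The projective norm as a seminorm. -/
def projSeminorm : Seminorm ℂ (ProjTensor A B) :=
  Seminorm.ofSMulLE projNorm projNorm_zero projNorm_add_le projNorm_smul_le

/-- The projective norm as a ring seminorm. -/
def projRingSeminorm : RingSeminorm (ProjTensor A B) where
  toAddGroupSeminorm := projSeminorm.toAddGroupSeminorm
  mul_le' := projNorm_mul_le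

instance : SeminormedCommRing (ProjTensor A B) where
  __ := (projRingSeminorm (A := A) (B := B)).toSeminormedRing
  mul_comm := mul_comm

lemma norm_def (t : ProjTensor A B) : ‖t‖ = projNorm t := rfl

instance : NormedAlgebra ℂ (ProjTensor A B) where
  norm_smul_le := projNorm_smul_le

lemma norm_one_eq [NormOneClass A] [NormOneClass B] : ‖(1 : ProjTensor A B)‖ = 1 := by
  have hA : ‖(1 : A)‖ ≠ 0 := by simp
  have hB : ‖(1 : B)‖ ≠ 0 := by simp
  obtain ⟨f, hf, hf1⟩ := exists_dual_vector ℂ (1 : A) hA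
  obtain ⟨g, hg, hg1⟩ := exists_dual_vector ℂ (1 : B) hB
  have e1 : (1 : ProjTensor A B) = tmul 1 1 := rfl
  rw [norm_def]
  apply le_antisymm
  · simpa [e1] using projNorm_le (costs_tmul (1 : A) (1 : B))
  · refine le_csInf (costs_nonempty _) fun r hr => ?_
    obtain ⟨l, hl, rfl⟩ := hr
    let φ : A ⊗[ℂ] B →ₗ[ℂ] ℂ :=
      LinearMap.mul' ℂ ℂ ∘ₗ TensorProduct.map f.toLinearMap g.toLinearMap
    have hφ : ∀ (a : A) (b : B), φ (a ⊗ₜ[ℂ] b) = f a * g b := fun a b => by simp [φ]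
    have hb : ∀ l : List (A × B), ‖φ ((l.map fun p => tmul p.1 p.2).sum : ProjTensor A B)‖ ≤
        (l.map fun p => ‖p.1‖ * ‖p.2‖).sum := by
      intro l
      induction l with
      | nil =>
        have h0 : φ (0 : A ⊗[ℂ] B) = 0 := map_zero φ
        simp only [List.map_nil, List.sum_nil]
        exact (norm_eq_zero.2 h0).le
      | cons p l ih =>
        simp only [List.map_cons, List.sum_cons]
        have hadd : φ (tmul p.1 p.2 + (l.map fun p => tmul p.1 p.2).sum : ProjTensor A B) =
            φ (p.1 ⊗ₜ[ℂ] p.2) + φ ((l.map fun p => tmul p.1 p.2).sum : ProjTensor A B) :=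
          map_add φ _ _
        rw [hadd]
        refine (norm_add_le _ _).trans (add_le_add ?_ ih)
        rw [hφ, norm_mul]
        have h1 := f.le_opNorm p.1
        have h2 := g.le_opNorm p.2
        rw [hf, one_mul] at h1
        rw [hg, one_mul] at h2
        gcongr
    have h := hb l
    rw [hl, e1] at h
    have hone : φ (tmul 1 1 : ProjTensor A B) = 1 := by
      have := hφ 1 1
      rw [hf1, hg1] at this
      exact this.trans (by simp)
    rwa [hone, norm_one] at h

instance [NormOneClass A] [NormOneClass B] : NormOneClass (ProjTensor A B) := ⟨norm_one_eq⟩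

instance [NormOneClass A] [NormOneClass B] :
    NormOneClass (UniformSpace.Completion (ProjTensor A B)) :=
  ⟨by rw [← UniformSpace.Completion.coe_one, UniformSpace.Completion.norm_coe, norm_one]⟩

end ProjTensor

end ProjectiveTensor

/-! ### The categories and the forgetful functors -/

/-- Unital normed algebras over `ℂ`, with submultiplicative norm and `‖1‖ = 1`. -/
structure NAlg : Type (u + 1) where
  carrier : Type u
  [normedRing : NormedRing carrier]
  [normedAlgebra : NormedAlgebra ℂ carrier]
  [normOneClass : NormOneClass carrier]

namespace NAlg

instance : CoeSort NAlg.{u} (Type u) := ⟨NAlg.carrier⟩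

attribute [instance] normedRing normedAlgebra normOneClass

/-- Contractive unital algebra homomorphisms. -/
@[ext]
structure Hom (A B : NAlg.{u}) where
  toAlgHom : A →ₐ[ℂ] B
  contractive : ∀ a : A, ‖toAlgHom a‖ ≤ ‖a‖

instance : Category NAlg.{u} where
  Hom := Hom
  id A := ⟨AlgHom.id ℂ A, fun _ => le_rfl⟩
  comp f g := ⟨g.toAlgHom.comp f.toAlgHom, fun a =>
    (g.contractive (f.toAlgHom a)).trans (f.contractive a)⟩

/-- Completeness, i.e. being a Banach algebra. -/
def IsBanach : ObjectProperty NAlg.{u} := fun A => CompleteSpace A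

end NAlg

/-- Unital Banach algebras over `ℂ`. -/
abbrev BanAlg : Type (u + 1) := NAlg.IsBanach.{u}.FullSubcategory

/-- Abstract unital operator algebras over `ℂ`, not necessarily complete. -/
structure OAlg : Type (u + 1) where
  carrier : Type u
  [normedRing : NormedRing carrier]
  [normedAlgebra : NormedAlgebra ℂ carrier]
  [normOneClass : NormOneClass carrier]
  [operatorAlgebra : OperatorAlgebra carrier]

namespace OAlg

instance : CoeSort OAlg.{u} (Type u) := ⟨OAlg.carrier⟩

attribute [instance] normedRing normedAlgebra normOneClass operatorAlgebra

/-- Completely contractive unital algebra homomorphisms. -/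
@[ext]
structure Hom (A B : OAlg.{u}) where
  toAlgHom : A →ₐ[ℂ] B
  completely_contractive : ∀ (n : ℕ) (a : Matrix (Fin n) (Fin n) A),
    OperatorSpace.mnorm n (a.map toAlgHom) ≤ OperatorSpace.mnorm n a

instance : Category OAlg.{u} where
  Hom := Hom
  id A := ⟨AlgHom.id ℂ A, fun _ _ => le_rfl⟩
  comp f g := ⟨g.toAlgHom.comp f.toAlgHom, fun n a =>
    (g.completely_contractive n (a.map f.toAlgHom)).trans (f.completely_contractive n a)⟩

/-- The forgetful functor from operator algebras to normed algebras. -/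
def forgetToNAlg : OAlg.{u} ⥤ NAlg.{u} where
  obj A := ⟨A⟩
  map {A B} f := ⟨f.toAlgHom, fun a => by
    have h := f.completely_contractive 1 (Matrix.of fun _ _ => a)
    rw [OperatorSpace.mnorm_one, OperatorSpace.mnorm_one] at h
    exact h⟩

/-- Completeness of an operator algebra. -/
def IsComplete : ObjectProperty OAlg.{u} := fun A => CompleteSpace A

end OAlg

/-- Complete unital operator algebras over `ℂ`. -/
abbrev COAlg : Type (u + 1) := OAlg.IsComplete.{u}.FullSubcategory

/-- The forgetful functor from complete operator algebras to Banach algebras. -/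
def COAlg.forgetToBanAlg : COAlg.{u} ⥤ BanAlg.{u} :=
  NAlg.IsBanach.lift (OAlg.IsComplete.ι ⋙ OAlg.forgetToNAlg) fun A => A.property

/-- The underlying function of a morphism of Banach algebras. -/
def BanAlg.fn {A B : BanAlg.{u}} (f : A ⟶ B) : A.obj → B.obj := f.hom.toAlgHom

/-- The underlying function of a morphism of complete operator algebras. -/
def COAlg.fn {A B : COAlg.{u}} (f : A ⟶ B) : A.obj → B.obj := f.hom.toAlgHom

/-! ### Abelianizations and the objects built from the disk -/

/-- `q : X ⟶ Y` is universal among the morphisms from `X` to objects with property `P`. -/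
def IsUniversalArrow {𝒞 : Type*} [Category 𝒞] (P : 𝒞 → Prop) {X Y : 𝒞} (q : X ⟶ Y) : Prop :=
  P Y ∧ ∀ Z : 𝒞, P Z → ∀ h : X ⟶ Z, ∃! k : Y ⟶ Z, q ≫ k = h

/-- `q : A ⟶ B` exhibits `B` as the abelianization of the Banach algebra `A`. -/
def BanAlg.IsAbelianization {A B : BanAlg.{u}} (q : A ⟶ B) : Prop :=
  IsUniversalArrow (fun C : BanAlg.{u} => ∀ x y : C.obj, x * y = y * x) q

/-- `q : A ⟶ B` exhibits `B` as the abelianization of the complete operator algebra `A`. -/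
def COAlg.IsAbelianization {A B : COAlg.{u}} (q : A ⟶ B) : Prop :=
  IsUniversalArrow (fun C : COAlg.{u} => ∀ x y : C.obj, x * y = y * x) q

/-- The closed unit disk of `ℂ`, placed in the universe `u`. -/
abbrev Disk : Type u := ULift.{u} (Metric.closedBall (0 : ℂ) 1)

instance : Nonempty Disk.{u} := ⟨⟨0, by simp⟩⟩

/-- `C(X)` as an operator algebra, for a nonempty compact space `X`. -/
abbrev OAlg.ofSpace (X : Type u) [TopologicalSpace X] [CompactSpace X] [Nonempty X] : OAlg.{u} :=
  ⟨C(X, ℂ)⟩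

/-- `C(X)` as a complete operator algebra, for a nonempty compact space `X`. -/
abbrev COAlg.ofSpace (X : Type u) [TopologicalSpace X] [CompactSpace X] [Nonempty X] :
    COAlg.{u} :=
  ⟨OAlg.ofSpace X, inferInstanceAs (CompleteSpace C(X, ℂ))⟩

/-- The completed projective tensor product of two unital commutative normed algebras, as a Banach
algebra. -/
abbrev BanAlg.projTensor (A B : Type u) [NormedCommRing A] [NormedAlgebra ℂ A] [NormOneClass A]
    [NormedCommRing B] [NormedAlgebra ℂ B] [NormOneClass B] : BanAlg.{u} :=
  ⟨⟨UniformSpace.Completion (ProjTensor A B)⟩,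
    inferInstanceAs (CompleteSpace (UniformSpace.Completion (ProjTensor A B)))⟩

end

/-! ### Normed algebras from seminorms, and extension of homomorphisms -/

/-! Coequalizers. The quotient of an operator algebra by the kernel of a contractive homomorphism
into any normed algebra is again an operator algebra, under the quotient matrix norms. So a
contractive homomorphism out of `U B` that coequalizes `U f` and `U g` factors as `U p` followed by
an injection (`OAlg.exists_quotient_ker`), and `p` already coequalizes `f` and `g`. With
faithfulness of `U`, this is all that preservation needs
(`preservesCoequalizers_of_factorizations`).

Coproducts. The two sides are compared through their abelianizations. A contractive homomorphism
from the coproduct to a commutative Banach algebra is a pair of homomorphisms with commuting images,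
so on the normed side the abelianization is the completed projective tensor product. On the operator
side it is `C(X × Y)`. The point is that completely contractive homomorphisms `f`, `g` from `C(X)`,
`C(Y)` into a commutative operator algebra are jointly dominated by the supremum norm. Approximate
`F` on `X × Y` by the interpolant with values `F(x_k, y_l)` and weights `p_k² q_l²`, where the
squares form partitions of unity. A sum of terms `f(p_k) v_k f(p_k)` is a row times a block diagonal
matrix times a column; row and column are images under `f` of matrices of norm at most `1`, so the
sum is bounded by the largest `‖v_k‖` (`OperatorAlgebra.mnorm_sum_conj_le`). Applying this for `g`
and then for `f`, and passing to the limit, gives `OAlg.mnorm_lift_le`. Quotients by kernels then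
show that `C(X × Y)` is also the abelianization among Banach algebras, and that the coproduct maps
onto it.

The canonical map `κ` from the completed projective tensor product to `C(X × Y)` is not onto for the
disk. Otherwise the open mapping theorem would lift tensors with a norm bound proportional to their
supremum norm. But on `n` separated points the tensor with coefficients the characters `ζ^(ij)` on
disjoint bumps has supremum norm at most `1`, while pairing with the conjugate coefficients gives
`n²` and is bounded by `n √n` in the projective norm (`exists_tensor_functional`). Since the
operator coproduct maps onto `C(X × Y)`, the comparison map cannot be onto either.

Without completeness there is no open mapping theorem, but isometry does the work: if the coproduct
were preserved, the maps into the projective tensor product would factor through a commutative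
operator algebra, and the projective norm would be at most the supremum norm, which fails for `n =
4`. -/

/-- An algebra with a unital submultiplicative seminorm maps densely into a Banach algebra. -/
theorem exists_denseRange_norm_eq {S : Type u} [Ring S] [Algebra ℂ S] (p : RingSeminorm S)
    (hone : p 1 = 1) (hsmul : ∀ (c : ℂ) s, p (c • s) ≤ ‖c‖ * p s) :
    ∃ (E : NAlg.{u}) (Φ : S →ₐ[ℂ] E), CompleteSpace E ∧ DenseRange Φ ∧ ∀ s, ‖Φ s‖ = p s := by
  let _ : SeminormedRing S := p.toSeminormedRing
  let _ : NormedAlgebra ℂ S := ⟨hsmul⟩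
  let _ : NormedAlgebra ℂ (UniformSpace.Completion S) :=
    { (inferInstance : Algebra ℂ (UniformSpace.Completion S)) with norm_smul_le := norm_smul_le }
  have _ : NormOneClass (UniformSpace.Completion S) :=
    ⟨by rw [← UniformSpace.Completion.coe_one, UniformSpace.Completion.norm_coe]; exact hone⟩
  refine ⟨⟨UniformSpace.Completion S⟩,
    { (UniformSpace.Completion.coeRingHom : S →+* UniformSpace.Completion S) with
      commutes' := fun c => rfl }, inferInstanceAs (CompleteSpace (UniformSpace.Completion S)),
    UniformSpace.Completion.denseRange_coe, fun s => UniformSpace.Completion.norm_coe s⟩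

/-- A homomorphism dominated in norm by a homomorphism `Φ` factors contractively through `Φ`, if
`Φ` is surjective, or if it has dense range and the target is complete. -/
theorem AlgHom.exists_contractive_factor {S E C : Type*} [Ring S] [Algebra ℂ S]
    [NormedRing E] [NormedAlgebra ℂ E] [NormedRing C] [NormedAlgebra ℂ C]
    (Φ : S →ₐ[ℂ] E) (φ : S →ₐ[ℂ] C) (h : ∀ s, ‖φ s‖ ≤ ‖Φ s‖)
    (hΦ : Function.Surjective Φ ∨ DenseRange Φ ∧ CompleteSpace C) :
    ∃ k : E →ₐ[ℂ] C, (∀ x, ‖k x‖ ≤ ‖x‖) ∧ ∀ s, k (Φ s) = φ s := by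
  rcases hΦ with hs | ⟨hd, hC⟩
  · have key : ∀ a b, Φ a = Φ b → φ a = φ b := fun a b hab => by
      have := h (a - b)
      rw [map_sub, map_sub, hab, sub_self, norm_zero] at this
      exact sub_eq_zero.1 (norm_le_zero_iff.1 this)
    have hr : ∀ s, φ (Function.surjInv hs (Φ s)) = φ s := fun s =>
      key _ _ (Function.surjInv_eq hs _)
    refine ⟨{ toFun := fun x => φ (Function.surjInv hs x)
              map_one' := by rw [← map_one Φ, hr, map_one]
              map_zero' := by rw [← map_zero Φ, hr, map_zero]
              map_mul' := ?_
              map_add' := ?_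
              commutes' := fun c => by rw [← Φ.commutes, hr, φ.commutes] }, ?_, hr⟩
    · intro x y
      obtain ⟨a, rfl⟩ := hs x
      obtain ⟨b, rfl⟩ := hs y
      rw [← map_mul, hr, hr, hr, map_mul]
    · intro x y
      obtain ⟨a, rfl⟩ := hs x
      obtain ⟨b, rfl⟩ := hs y
      rw [← map_add, hr, hr, hr, map_add]
    · intro x
      obtain ⟨a, rfl⟩ := hs x
      exact (hr a ▸ h a :)
  · let k : E →L[ℂ] C := φ.toLinearMap.extendOfNorm Φ.toLinearMap
    have hk : ∀ s, k (Φ s) = φ s := fun s =>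
      LinearMap.extendOfNorm_eq (f := φ.toLinearMap) (e := Φ.toLinearMap) hd
        ⟨1, fun s => by simpa using h s⟩ s
    have hn : ∀ x, ‖k x‖ ≤ ‖x‖ := fun x => by
      have := LinearMap.norm_extendOfNorm_apply_le (f := φ.toLinearMap) (e := Φ.toLinearMap) hd 1
        (fun s => by simpa using h s) x
      simpa using this
    refine ⟨AlgHom.ofLinearMap k.toLinearMap ?_ ?_, hn, hk⟩
    · have h1 := hk 1
      rw [map_one Φ, map_one φ] at h1
      exact h1
    · intro x y
      refine hd.induction_on₂ (p := fun x y => k (x * y) = k x * k y) ?_ ?_ x y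
      · exact isClosed_eq (by fun_prop) (by fun_prop)
      · intro a b
        rw [← map_mul, hk, hk, hk, map_mul]

lemma NAlg.Hom.continuous {A B : NAlg.{u}} (f : A ⟶ B) : Continuous f.toAlgHom :=
  (AddMonoidHomClass.lipschitz_of_bound f.toAlgHom 1 fun a => by
    simpa using f.contractive a).continuous

lemma NAlg.Hom.eq_of_forall {A B : NAlg.{u}} {f g : A ⟶ B}
    (h : ∀ x, f.toAlgHom x = g.toAlgHom x) : f = g :=
  NAlg.Hom.ext (AlgHom.ext h)

lemma NAlg.Hom.apply_congr {A B : NAlg.{u}} {f g : A ⟶ B} (h : f = g) (x : A) :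
    f.toAlgHom x = g.toAlgHom x := h ▸ rfl

/-- Two normed algebras `A` and `B` with a family of pairs of contractive homomorphisms into
algebras `C i` map to an algebra `E` which they generate, and whose norm is the supremum of the
norms of the `C i`. -/
theorem NAlg.exists_joint {A B : NAlg.{u}} {𝒦 : ObjectProperty NAlg.{u}}
    (h𝒦 : 𝒦 = ⊤ ∨ 𝒦 = NAlg.IsBanach) {ι : Type*} [Nonempty ι] (C : ι → NAlg.{u})
    (hC : ∀ i, 𝒦 (C i)) (f : ∀ i, A ⟶ C i) (g : ∀ i, B ⟶ C i) :
    ∃ (E : NAlg.{u}) (inl : A ⟶ E) (inr : B ⟶ E) (φ : ∀ i, E ⟶ C i), 𝒦 E ∧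
      (∀ i, inl ≫ φ i = f i) ∧ (∀ i, inr ≫ φ i = g i) ∧
      (∀ x (M : ℝ), (∀ i, ‖(φ i).toAlgHom x‖ ≤ M) → ‖x‖ ≤ M) ∧
      ∀ (D : NAlg.{u}) (k k' : E ⟶ D), inl ≫ k = inl ≫ k' → inr ≫ k = inr ≫ k' → k = k' := by
  let S := FreeAlgebra ℂ (A ⊕ B)
  let ψ : ∀ i, S →ₐ[ℂ] C i := fun i =>
    FreeAlgebra.lift ℂ (Sum.elim (f i).toAlgHom (g i).toAlgHom)
  have hψl : ∀ i a, ψ i (FreeAlgebra.ι ℂ (Sum.inl a)) = (f i).toAlgHom a := fun i a =>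
    FreeAlgebra.lift_ι_apply _ _
  have hψr : ∀ i a, ψ i (FreeAlgebra.ι ℂ (Sum.inr a)) = (g i).toAlgHom a := fun i a =>
    FreeAlgebra.lift_ι_apply _ _
  -- Each generator is bounded by its norm in `A` or `B`, independently of `i`, so the supremum
  -- below is finite.
  have hb : ∀ s, ∃ M, ∀ i, ‖ψ i s‖ ≤ M := by
    intro s
    induction s using FreeAlgebra.induction with
    | grade0 c => exact ⟨‖c‖, fun i => by
      rw [AlgHom.commutes, norm_algebraMap, norm_one, mul_one]⟩
    | grade1 x =>
      rcases x with a | b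
      · exact ⟨‖a‖, fun i => by rw [hψl]; exact (f i).contractive a⟩
      · exact ⟨‖b‖, fun i => by rw [hψr]; exact (g i).contractive b⟩
    | mul s t hs ht =>
      obtain ⟨M, hM⟩ := hs
      obtain ⟨N, hN⟩ := ht
      refine ⟨M * N, fun i => ?_⟩
      rw [map_mul]
      exact (norm_mul_le _ _).trans
        (mul_le_mul (hM i) (hN i) (norm_nonneg _) ((norm_nonneg _).trans (hM i)))
    | add s t hs ht =>
      obtain ⟨M, hM⟩ := hs
      obtain ⟨N, hN⟩ := ht
      refine ⟨M + N, fun i => ?_⟩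
      rw [map_add]
      exact (norm_add_le _ _).trans (add_le_add (hM i) (hN i))
  let p : S → ℝ := fun s => ⨆ i, ‖ψ i s‖
  have hp : ∀ s i, ‖ψ i s‖ ≤ p s := fun s i => by
    obtain ⟨M, hM⟩ := hb s
    exact le_ciSup (f := fun i => ‖ψ i s‖) ⟨M, by rintro _ ⟨i, rfl⟩; exact hM i⟩ i
  have hp' : ∀ s M, (∀ i, ‖ψ i s‖ ≤ M) → p s ≤ M := fun s M h => ciSup_le h
  have hp0 : ∀ s, 0 ≤ p s := fun s => Real.iSup_nonneg fun _ => norm_nonneg _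
  let q : RingSeminorm S :=
    { toFun := p
      map_zero' := le_antisymm (hp' _ _ fun i => by simp) (hp0 _)
      add_le' := fun s t => hp' _ _ fun i => by
        rw [map_add]; exact (norm_add_le _ _).trans (add_le_add (hp s i) (hp t i))
      neg' := fun s => by simp [p]
      mul_le' := fun s t => hp' _ _ fun i => by
        rw [map_mul]
        exact (norm_mul_le _ _).trans
          (mul_le_mul (hp s i) (hp t i) (norm_nonneg _) (hp0 s)) }
  -- `p 1 = 1` uses that `ι` is nonempty; an empty real supremum is `0`.
  obtain ⟨E, Φ, hE, hΦd, hΦn⟩ := exists_denseRange_norm_eq q (show p 1 = 1 by simp [p]) fun c s =>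
    hp' _ _ fun i => by
      rw [map_smul, norm_smul]
      exact mul_le_mul_of_nonneg_left (hp s i) (norm_nonneg c)
  -- the common construction, from a map with dense or full range
  have main : ∀ (E : NAlg.{u}) (Φ : S →ₐ[ℂ] E), 𝒦 E → DenseRange Φ → (∀ s, ‖Φ s‖ = p s) →
      (∀ i, Function.Surjective Φ ∨ DenseRange Φ ∧ CompleteSpace (C i)) →
      ∃ (inl : A ⟶ E) (inr : B ⟶ E) (φ : ∀ i, E ⟶ C i), 𝒦 E ∧
      (∀ i, inl ≫ φ i = f i) ∧ (∀ i, inr ≫ φ i = g i) ∧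
      (∀ x (M : ℝ), (∀ i, ‖(φ i).toAlgHom x‖ ≤ M) → ‖x‖ ≤ M) ∧
      ∀ (D : NAlg.{u}) (k k' : E ⟶ D), inl ≫ k = inl ≫ k' → inr ≫ k = inr ≫ k' → k = k' := by
    intro E Φ hE hd hn hs
    choose k hk hkΦ using fun i =>
      AlgHom.exists_contractive_factor Φ (ψ i) (fun s => (hn s).symm ▸ hp s i) (hs i)
    -- An identity valid under every `ψ i` holds in `E`. This imposes the relations of `A` and `B`
    -- on the free generators and makes `inl` and `inr` homomorphisms.
    have heq : ∀ s t, (∀ i, ψ i s = ψ i t) → Φ s = Φ t := fun s t h => by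
      rw [← sub_eq_zero, ← map_sub, ← norm_le_zero_iff, hn]
      exact hp' _ _ fun i => by rw [map_sub, h, sub_self, norm_zero]
    have hgen : ∀ (A : NAlg.{u}) (f : ∀ i, A ⟶ C i) (j : A → S)
        (hj : ∀ i a, ψ i (j a) = (f i).toAlgHom a),
        ∃ inl : A ⟶ E, ∀ a, inl.toAlgHom a = Φ (j a) := by
      intro A f j hj
      refine ⟨⟨{ toFun := fun a => Φ (j a), map_one' := ?_, map_zero' := ?_, map_add' := ?_,
                 map_mul' := ?_, commutes' := ?_ }, fun a => ?_⟩, fun a => rfl⟩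
      · rw [← map_one Φ]; exact heq _ _ fun i => by simp [hj]
      · intro a b; rw [← map_mul Φ]; exact heq _ _ fun i => by simp [hj]
      · rw [← map_zero Φ]; exact heq _ _ fun i => by simp [hj]
      · intro a b; rw [← map_add Φ]; exact heq _ _ fun i => by simp [hj]
      · intro c; rw [← Φ.commutes]; exact heq _ _ fun i => by simp [hj]
      · change ‖Φ (j a)‖ ≤ _
        rw [hn]
        exact hp' _ _ fun i => by rw [hj]; exact (f i).contractive a
    obtain ⟨inl, hinl⟩ := hgen A f (fun a => FreeAlgebra.ι ℂ (Sum.inl a)) hψl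
    obtain ⟨inr, hinr⟩ := hgen B g (fun a => FreeAlgebra.ι ℂ (Sum.inr a)) hψr
    refine ⟨inl, inr, fun i => ⟨k i, hk i⟩, hE, fun i => ?_, fun i => ?_, ?_, ?_⟩
    · refine NAlg.Hom.eq_of_forall fun a => ?_
      change k i (inl.toAlgHom a) = _
      rw [hinl, hkΦ, hψl]
    · refine NAlg.Hom.eq_of_forall fun a => ?_
      change k i (inr.toAlgHom a) = _
      rw [hinr, hkΦ, hψr]
    · intro x M hM
      -- The norm of `E` is the supremum on the range of `Φ` by construction; other `x` are
      -- approximated, with one `ε / 2` for `‖x - Φ s‖` and one for its images.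
      refine le_of_forall_pos_le_add fun ε hε => ?_
      obtain ⟨s, hsx⟩ := hd.exists_dist_lt x (half_pos hε)
      rw [dist_eq_norm] at hsx
      have h1 : ‖Φ s‖ ≤ M + ε / 2 := by
        rw [hn]
        refine hp' _ _ fun i => ?_
        have h2 : ψ i s = k i x - k i (x - Φ s) := by rw [← map_sub, sub_sub_cancel, hkΦ]
        rw [h2]
        exact (norm_sub_le _ _).trans (add_le_add (hM i) ((hk i _).trans hsx.le))
      have h3 : ‖x‖ ≤ ‖x - Φ s‖ + ‖Φ s‖ := by simpa using norm_add_le (x - Φ s) (Φ s)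
      linarith
    · intro D k k' hl hr
      have h1 : k.toAlgHom.comp Φ = k'.toAlgHom.comp Φ := by
        refine FreeAlgebra.hom_ext (funext fun x => ?_)
        rcases x with a | b
        · have := NAlg.Hom.apply_congr hl a
          change k.toAlgHom (inl.toAlgHom a) = k'.toAlgHom (inl.toAlgHom a) at this
          rwa [hinl] at this
        · have := NAlg.Hom.apply_congr hr b
          change k.toAlgHom (inr.toAlgHom b) = k'.toAlgHom (inr.toAlgHom b) at this
          rwa [hinr] at this
      refine NAlg.Hom.eq_of_forall fun x => ?_
      refine congrFun (hd.equalizer (NAlg.Hom.continuous k) (NAlg.Hom.continuous k') ?_) x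
      exact funext fun s => DFunLike.congr_fun h1 s
  -- Without completeness the object is the image of the free algebra in the completion, which also
  -- divides out the null space of the seminorm.
  rcases h𝒦 with rfl | rfl
  · have _ : NormOneClass Φ.range := ⟨norm_one (α := E)⟩
    refine ⟨⟨Φ.range⟩, main ⟨Φ.range⟩ Φ.rangeRestrict trivial
      Φ.rangeRestrict_surjective.denseRange hΦn fun i => Or.inl Φ.rangeRestrict_surjective⟩
  · exact ⟨E, main E Φ hE hΦd hΦn fun i => Or.inr ⟨hΦd, hC i⟩⟩

/-! ### Operator spaces -/

section OperatorSpaceLemmas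

open scoped Matrix.Norms.L2Operator

namespace OperatorSpace

variable {V : Type u} [NormedAddCommGroup V] [NormedSpace ℂ V] [OperatorSpace V]

/-- The zero-one matrix of a map. -/
def selectMatrix {m n : ℕ} (e : Fin n → Fin m) : Matrix (Fin n) (Fin m) ℂ :=
  Matrix.of fun i k => if k = e i then 1 else 0

lemma norm_selectMatrix_le {m n : ℕ} {e : Fin n → Fin m} (he : Function.Injective e) :
    ‖selectMatrix e‖ ≤ 1 := by
  refine l2_opNorm_le_of_sq _ zero_le_one fun x => ?_
  have : ∀ i, (selectMatrix e).mulVec x i = x (e i) := fun i => by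
    simp [selectMatrix, Matrix.mulVec, dotProduct]
  simp only [this, one_pow, one_mul]
  rw [← Finset.sum_image (f := fun k => ‖x k‖ ^ 2) (s := Finset.univ) (g := e) he.injOn]
  exact Finset.sum_le_sum_of_subset_of_nonneg (Finset.subset_univ _) fun _ _ _ => by positivity

lemma norm_selectMatrix_transpose_le {m n : ℕ} {e : Fin n → Fin m} (he : Function.Injective e) :
    ‖(selectMatrix e).transpose‖ ≤ 1 := by
  have : (selectMatrix e).transpose = (selectMatrix e).conjTranspose := by
    ext i j
    simp [selectMatrix, apply_ite]
  rw [this, Matrix.l2_opNorm_conjTranspose]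
  exact norm_selectMatrix_le he

/-- Selecting rows and columns is a two-sided multiplication by zero-one matrices, which are
contractions because the index maps are injective. -/
lemma mnorm_submatrix_le {m n : ℕ} {e f : Fin n → Fin m} (he : Function.Injective e)
    (hf : Function.Injective f) (v : Matrix (Fin m) (Fin m) V) :
    mnorm n (v.submatrix e f) ≤ mnorm m v := by
  have h := mnorm_compress m n (selectMatrix e) v (selectMatrix f).transpose
  have h1 : (Matrix.of fun i j => ∑ k, ∑ l,
      (selectMatrix e i k * (selectMatrix f).transpose l j) • v k l) = v.submatrix e f := by
    ext i j
    simp [selectMatrix, Matrix.transpose]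
  rw [h1] at h
  refine h.trans ?_
  calc _ ≤ 1 * mnorm m v * 1 := by
        gcongr
        · exact norm_selectMatrix_le he
        · exact norm_selectMatrix_transpose_le hf
    _ = _ := by ring

lemma norm_entry_le {n : ℕ} (v : Matrix (Fin n) (Fin n) V) (i j : Fin n) :
    ‖v i j‖ ≤ mnorm n v := by
  have h := mnorm_submatrix_le (e := fun _ : Fin 1 => i) (f := fun _ => j)
    (Function.injective_of_subsingleton _) (Function.injective_of_subsingleton _) v
  rwa [mnorm_one] at h

lemma mnorm_single_le {n : ℕ} (i j : Fin n) (a : V) : mnorm n (Matrix.single i j a) ≤ ‖a‖ := by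
  have hi : Function.Injective fun _ : Fin 1 => i := Function.injective_of_subsingleton _
  have hj : Function.Injective fun _ : Fin 1 => j := Function.injective_of_subsingleton _
  have h := mnorm_compress 1 n (selectMatrix fun _ => i).transpose (Matrix.of fun _ _ => a)
    (selectMatrix fun _ => j)
  rw [mnorm_one] at h
  have h1 : (Matrix.of fun k l => ∑ x : Fin 1, ∑ y : Fin 1,
      ((selectMatrix fun _ => i).transpose k x * selectMatrix (fun _ => j) y l) •
        (Matrix.of fun _ _ => a : Matrix (Fin 1) (Fin 1) V) x y) = Matrix.single i j a := by
    ext k l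
    by_cases hk : i = k <;> by_cases hl : j = l <;>
      simp [selectMatrix, Matrix.single, hk, hl, eq_comm]
  rw [h1] at h
  refine h.trans ?_
  calc _ ≤ 1 * ‖a‖ * 1 := by
        gcongr
        · exact norm_selectMatrix_transpose_le hi
        · exact le_rfl
        · exact norm_selectMatrix_le hj
    _ = _ := by ring

/-- A crude bound that turns entrywise approximation into approximation in the matrix norms, and
entrywise bounds into finiteness of suprema. -/
lemma mnorm_le_sum {n : ℕ} (v : Matrix (Fin n) (Fin n) V) :
    mnorm n v ≤ ∑ i, ∑ j, ‖v i j‖ := by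
  conv_lhs => rw [Matrix.matrix_eq_sum_single v]
  refine (Finset.le_sum_of_subadditive (mnorm n) (map_zero _).le (map_add_le_add _) _ _).trans
    (Finset.sum_le_sum fun i _ => ?_)
  exact (Finset.le_sum_of_subadditive (mnorm n) (map_zero _).le (map_add_le_add _) _ _).trans
    (Finset.sum_le_sum fun j _ => mnorm_single_le i j _)

/-- The matrix norm of a block diagonal matrix. -/
lemma mnorm_blockDiagonal_le {n : ℕ} {M : ℝ} (hM : 0 ≤ M) :
    ∀ {K : ℕ} (v : Fin K → Matrix (Fin n) (Fin n) V) (_ : ∀ k, mnorm n (v k) ≤ M) {N : ℕ}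
      (e : Fin N ≃ Fin n × Fin K),
      mnorm N ((Matrix.blockDiagonal v).submatrix e e) ≤ M
  | 0, v, _, N, e => by
    have : (Matrix.blockDiagonal v).submatrix e e = 0 := by
      ext i
      exact (e i).2.elim0
    rw [this, map_zero]
    exact hM
  | K + 1, v, hv, N, e => by
    have ih := mnorm_blockDiagonal_le hM (fun k => v k.succ) (fun k => hv _)
      (finProdFinEquiv (m := n) (n := K)).symm
    have h := mnorm_directSum n (n * K) (v 0)
      ((Matrix.blockDiagonal fun k => v k.succ).submatrix finProdFinEquiv.symm finProdFinEquiv.symm)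
    -- `t` splits off the block with index `0`; the other blocks have indices `k.succ`, so that the
    -- direct sum axiom and induction apply after a permutation.
    let t : Fin (n + n * K) ≃ Fin n × Fin (K + 1) :=
      finSumFinEquiv.symm.trans
      { toFun := Sum.elim (fun i => (i, 0)) fun j =>
          ((finProdFinEquiv.symm j).1, (finProdFinEquiv.symm j).2.succ)
        invFun := fun x => Fin.cases (Sum.inl x.1) (fun k => Sum.inr (finProdFinEquiv (x.1, k))) x.2
        left_inv := by
          rintro (i | j)
          · rfl
          · exact congrArg Sum.inr (finProdFinEquiv.apply_symm_apply j)
        right_inv := by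
          rintro ⟨i, k⟩
          induction k using Fin.cases with
          | zero => rfl
          | succ k => simp only [Fin.cases_succ, Sum.elim_inr, Equiv.symm_apply_apply] }
    have h1 : (Matrix.blockDiagonal v).submatrix e e = (Matrix.reindex finSumFinEquiv finSumFinEquiv
        (Matrix.fromBlocks (v 0) 0 0 ((Matrix.blockDiagonal fun k => v k.succ).submatrix
          finProdFinEquiv.symm finProdFinEquiv.symm))).submatrix (e.trans t.symm)
            (e.trans t.symm) := by
      have h2 : Matrix.reindex finSumFinEquiv finSumFinEquiv
        (Matrix.fromBlocks (v 0) 0 0 ((Matrix.blockDiagonal fun k => v k.succ).submatrix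
          finProdFinEquiv.symm finProdFinEquiv.symm)) = (Matrix.blockDiagonal v).submatrix t t := by
        ext a b
        obtain ⟨a, rfl⟩ := finSumFinEquiv.surjective a
        obtain ⟨b, rfl⟩ := finSumFinEquiv.surjective b
        rcases a with a | a <;> rcases b with b | b <;>
          simp [t, Matrix.blockDiagonal_apply, Fin.succ_ne_zero, (Fin.succ_ne_zero _).symm]
      rw [h2, Matrix.submatrix_submatrix]
      congr 1 <;> ext x <;> simp
    rw [h1]
    refine (mnorm_submatrix_le (Equiv.injective _) (Equiv.injective _) _).trans ?_
    rw [h]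
    exact max_le (hv 0) ih

end OperatorSpace

/-! ### Compression by partitions of unity -/

/-- The supremum norm on `M_N(C(X))` of a matrix supported in one block row. -/
lemma supMatrixNorm_blockRow_le {X : Type u} [TopologicalSpace X] {n K : ℕ} (k₀ : Fin K)
    (p : Fin K → C(X, ℂ)) (hp : ∀ x, ∑ k, ‖p k x‖ ^ 2 ≤ 1) {N : ℕ} (e : Fin N ≃ Fin n × Fin K)
    (F : Matrix (Fin N) (Fin N) C(X, ℂ))
    (hF : ∀ a b, F a b = if (e a).2 = k₀ ∧ (e a).1 = (e b).1 then p (e b).2 else 0) :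
    supMatrixNorm X N F ≤ 1 := by
  refine supMatrixNorm_le X N F zero_le_one fun x => l2_opNorm_le_of_sq _ zero_le_one fun z => ?_
  have h1 : ∀ i k, ((F.map fun f => f x).mulVec z) (e.symm (i, k)) =
      if k = k₀ then ∑ l, p l x * z (e.symm (i, l)) else 0 := by
    intro i k
    simp only [Matrix.mulVec, dotProduct, Matrix.map_apply, hF, Equiv.apply_symm_apply]
    rw [← e.symm.sum_comp, Fintype.sum_prod_type]
    simp only [Equiv.apply_symm_apply]
    split_ifs with h
    · rw [Finset.sum_eq_single i]
      · simp [h]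
      · intro j _ hj
        simp [hj.symm]
      · simp
    · simp [h]
  rw [← e.symm.sum_comp, Fintype.sum_prod_type, ← e.symm.sum_comp, Fintype.sum_prod_type, one_pow,
    one_mul]
  refine Finset.sum_le_sum fun i _ => ?_
  simp only [h1]
  rw [Finset.sum_eq_single k₀ (fun k _ hk => by simp [hk]) (by simp), if_pos rfl]
  -- Cauchy–Schwarz in the block index; the squares of the `p l x` sum to at most `1`.
  calc ‖∑ l, p l x * z (e.symm (i, l))‖ ^ 2 ≤ (∑ l, ‖p l x‖ * ‖z (e.symm (i, l))‖) ^ 2 := by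
        gcongr
        exact (norm_sum_le _ _).trans (Finset.sum_le_sum fun l _ => norm_mul_le _ _)
    _ ≤ (∑ l, ‖p l x‖ ^ 2) * ∑ l, ‖z (e.symm (i, l))‖ ^ 2 := Finset.sum_mul_sq_le_sq_mul_sq _ _ _
    _ ≤ 1 * ∑ l, ‖z (e.symm (i, l))‖ ^ 2 := by
        gcongr
        exact hp x
    _ = _ := one_mul _

/-- The transpose of a matrix of real functions has the same supremum norm. -/
lemma supMatrixNorm_transpose {X : Type u} [TopologicalSpace X] {N : ℕ}
    (F : Matrix (Fin N) (Fin N) C(X, ℂ)) (hF : ∀ a b x, star (F a b x) = F a b x) :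
    supMatrixNorm X N F.transpose = supMatrixNorm X N F := by
  refine iSup_congr fun x => ?_
  rw [← Matrix.l2_opNorm_conjTranspose (F.map fun f => f x)]
  congr 1
  ext a b
  exact (hF b a x).symm

lemma OAlg.Hom.mnorm_map_le {A B : OAlg.{u}} (f : A ⟶ B) (n : ℕ) (a : Matrix (Fin n) (Fin n) A) :
    OperatorSpace.mnorm n (a.map f.toAlgHom) ≤ OperatorSpace.mnorm n a :=
  f.completely_contractive n a

/-- Compressing a family of matrices over an operator algebra by a partition of unity of squares
does not increase norms. -/
theorem OperatorAlgebra.mnorm_sum_conj_le {X : Type u} [TopologicalSpace X] [CompactSpace X]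
    [Nonempty X] {C : OAlg.{u}} (f : OAlg.ofSpace X ⟶ C) {n K : ℕ} (p : Fin K → C(X, ℂ))
    (hp : ∀ x, ∑ k, ‖p k x‖ ^ 2 ≤ 1) (hreal : ∀ k x, star (p k x) = p k x)
    (v : Fin K → Matrix (Fin n) (Fin n) C) {M : ℝ} (hM : 0 ≤ M)
    (hv : ∀ k, OperatorSpace.mnorm n (v k) ≤ M) :
    OperatorSpace.mnorm n (Matrix.of fun i j => ∑ k, f.toAlgHom (p k) * v k i j *
      f.toAlgHom (p k)) ≤ M := by
  -- For an empty family the sum is `0`; otherwise block index `0` is available to carry the row.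
  rcases K with _ | K
  · have : (Matrix.of fun i j => ∑ k, f.toAlgHom (p k) * v k i j * f.toAlgHom (p k)) = 0 := by
      ext i j; simp
    rw [this, map_zero]
    exact hM
  let e : Fin (n * (K + 1)) ≃ Fin n × Fin (K + 1) := finProdFinEquiv.symm
  -- The row of blocks `p k • 1`, padded with zero rows to a square matrix because only square
  -- matrices are normed. With `D` the block diagonal of the `v k`, the wanted sum is the `(0, 0)`
  -- block of the product `R * D * S`.
  let F : Matrix (Fin (n * (K + 1))) (Fin (n * (K + 1))) C(X, ℂ) := Matrix.of fun a b =>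
    if (e a).2 = 0 ∧ (e a).1 = (e b).1 then p (e b).2 else 0
  have hF1 : supMatrixNorm X _ F ≤ 1 := supMatrixNorm_blockRow_le 0 p hp e F fun a b => rfl
  have hF2 : supMatrixNorm X _ F.transpose ≤ 1 := by
    rw [supMatrixNorm_transpose F]
    · exact hF1
    · intro a b x
      simp only [F, Matrix.of_apply]
      split_ifs
      · exact hreal _ _
      · simp
  have hf1 := (OAlg.Hom.mnorm_map_le f _ F).trans hF1
  have hf2 := (OAlg.Hom.mnorm_map_le f _ F.transpose).trans hF2
  have hd := OperatorSpace.mnorm_blockDiagonal_le hM v hv e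
  set D := (Matrix.blockDiagonal v).submatrix e e with hD
  set R := F.map f.toAlgHom with hR
  set S := F.transpose.map f.toAlgHom with hS
  have hprod : OperatorSpace.mnorm _ (R * D * S) ≤ M := by
    refine (OperatorAlgebra.mnorm_mul_le _ _ _).trans ?_
    refine (mul_le_mul (OperatorAlgebra.mnorm_mul_le _ _ _) le_rfl (apply_nonneg _ _)
      (by positivity)).trans ?_
    calc _ ≤ 1 * M * 1 := by gcongr
      _ = M := by ring
  have hinj : Function.Injective fun i : Fin n => e.symm (i, 0) := fun i j h => by
    simpa using h
  have hsub : (Matrix.of fun i j => ∑ k, f.toAlgHom (p k) * v k i j * f.toAlgHom (p k)) =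
      (R * D * S).submatrix (fun i : Fin n => e.symm (i, 0)) fun i : Fin n => e.symm (i, 0) := by
    ext i j
    simp only [Matrix.of_apply, Matrix.submatrix_apply, Matrix.mul_apply, Finset.sum_mul]
    rw [← e.symm.sum_comp, Fintype.sum_prod_type]
    simp only [← e.symm.sum_comp fun a => R _ a * D a _ * S _ _, Fintype.sum_prod_type]
    have hRe : ∀ i' k, R (e.symm (i, 0)) (e.symm (i', k)) =
        if i = i' then f.toAlgHom (p k) else 0 := fun i' k => by
      by_cases h : i = i' <;> simp [hR, F, h]
    have hSe : ∀ i' k, S (e.symm (i', k)) (e.symm (j, 0)) =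
        if j = i' then f.toAlgHom (p k) else 0 := fun i' k => by
      by_cases h : j = i' <;> simp [hS, F, h]
    have hDe : ∀ i' k j' l, D (e.symm (i', k)) (e.symm (j', l)) =
        if k = l then v k i' j' else 0 := fun i' k j' l => by
      simp [hD, Matrix.blockDiagonal_apply]
    simp only [hRe, hSe, hDe]
    simp
  rw [hsub]
  exact (OperatorSpace.mnorm_submatrix_le hinj hinj _).trans hprod

end OperatorSpaceLemmas

lemma le_mul_of_forall_pos_le {a b c : ℝ} (h : ∀ ε > 0, c ≤ (a + ε) * (b + ε)) : c ≤ a * b := by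
  have hcont : Filter.Tendsto (fun ε : ℝ => (a + ε) * (b + ε))
      (nhdsWithin 0 (Set.Ioi 0)) (nhds ((a + 0) * (b + 0))) :=
    (Continuous.tendsto (by fun_prop) 0).mono_left nhdsWithin_le_nhds
  rw [add_zero, add_zero] at hcont
  exact ge_of_tendsto hcont (by filter_upwards [self_mem_nhdsWithin] with ε hε using h ε hε)

/-! ### Operator algebra structures induced by families of homomorphisms and on quotients -/

section

open OperatorSpace

/-- A normed algebra whose norm is determined by a family of contractive homomorphisms into operator
algebras carries the operator algebra structure determined by this family. -/
theorem OperatorAlgebra.exists_joint {E : NAlg.{u}} {ι : Type*} [Nonempty ι] (C : ι → OAlg.{u})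
    (φ : ∀ i, E ⟶ OAlg.forgetToNAlg.obj (C i))
    (hφ : ∀ x (M : ℝ), (∀ i, ‖(φ i).toAlgHom x‖ ≤ M) → ‖x‖ ≤ M) :
    ∃ _ : OperatorAlgebra E,
      (∀ i n (v : Matrix (Fin n) (Fin n) E),
        mnorm (V := C i) n (v.map (φ i).toAlgHom) ≤ mnorm n v) ∧
      ∀ n (v : Matrix (Fin n) (Fin n) E) (M : ℝ),
        (∀ i, mnorm (V := C i) n (v.map (φ i).toAlgHom) ≤ M) → mnorm n v ≤ M := by
  let ψ : ∀ i, E →ₐ[ℂ] C i := fun i => (φ i).toAlgHom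
  let N : ∀ n, Matrix (Fin n) (Fin n) E → ℝ := fun n v => ⨆ i, mnorm n (v.map (ψ i))
  have hle : ∀ n v i, mnorm n (v.map (ψ i)) ≤ N n v := fun n v i => by
    refine le_ciSup (f := fun i => mnorm n (v.map (ψ i))) ⟨∑ k, ∑ l, ‖v k l‖, ?_⟩ i
    rintro _ ⟨i, rfl⟩
    exact (mnorm_le_sum _).trans (Finset.sum_le_sum fun k _ => Finset.sum_le_sum fun l _ =>
      (φ i).contractive _)
  have hge : ∀ n v M, (∀ i, mnorm n (v.map (ψ i)) ≤ M) → N n v ≤ M := fun n v M h => ciSup_le h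
  have h0 : ∀ n v, 0 ≤ N n v := fun n v => Real.iSup_nonneg fun i => apply_nonneg _ _
  -- This is where `hφ` enters: the entries are controlled by the family, which yields both
  -- definiteness and agreement with the norm of `E` on `1 × 1` matrices.
  have hent : ∀ n v k l, ‖v k l‖ ≤ N n v := fun n v k l => hφ _ _ fun i =>
    (norm_entry_le (v.map (ψ i)) k l).trans (hle n v i)
  refine ⟨{ mnorm := fun n => Seminorm.ofSMulLE (N n) ?_ ?_ ?_
            eq_zero_of_mnorm := ?_
            mnorm_one := ?_
            mnorm_directSum := ?_
            mnorm_compress := ?_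
            mnorm_mul_le := ?_ }, fun i n v => hle n v i, fun n v M h => hge n v M h⟩
  · refine le_antisymm (hge _ _ _ fun i => ?_) (h0 _ _)
    rw [Matrix.map_zero _ (map_zero _), map_zero]
  · intro v w
    refine hge _ _ _ fun i => ?_
    rw [Matrix.map_add _ (map_add _)]
    exact (map_add_le_add _ _ _).trans (add_le_add (hle n v i) (hle n w i))
  · intro c v
    refine hge _ _ _ fun i => ?_
    rw [Matrix.map_smul _ _ (map_smul (ψ i) c), map_smul_eq_mul]
    exact mul_le_mul_of_nonneg_left (hle n v i) (norm_nonneg c)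
  · intro n v hv
    ext k l
    exact norm_le_zero_iff.1 ((hent n v k l).trans_eq hv)
  · intro v
    refine le_antisymm (hge _ _ _ fun i => ?_) (hent 1 v 0 0)
    rw [mnorm_one]
    exact (φ i).contractive _
  · intro m n v w
    have key : ∀ i, mnorm (m + n) ((Matrix.reindex finSumFinEquiv finSumFinEquiv
        (Matrix.fromBlocks v 0 0 w)).map (ψ i)) =
        max (mnorm m (v.map (ψ i))) (mnorm n (w.map (ψ i))) := fun i => by
      rw [← mnorm_directSum]
      congr 1
      simp only [Matrix.reindex_apply, ← Matrix.submatrix_map, Matrix.fromBlocks_map,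
        Matrix.map_zero _ (map_zero (ψ i))]
    refine le_antisymm (hge _ _ _ fun i => ?_) (max_le (hge _ _ _ fun i => ?_)
      (hge _ _ _ fun i => ?_))
    · rw [key]
      exact max_le_max (hle _ _ _) (hle _ _ _)
    · exact (le_max_left _ _).trans ((key i).symm.le.trans (hle _ _ _))
    · exact (le_max_right _ _).trans ((key i).symm.le.trans (hle _ _ _))
  · intro m n α v β
    refine hge _ _ _ fun i => ?_
    have h1 : (Matrix.of fun k l => ∑ a, ∑ b, (α k a * β b l) • v a b).map (ψ i) =
        Matrix.of fun k l => ∑ a, ∑ b, (α k a * β b l) • (v.map (ψ i)) a b := by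
      ext k l
      simp
    rw [h1]
    refine (mnorm_compress _ _ _ _ _).trans ?_
    open scoped Matrix.Norms.L2Operator in
    gcongr
    exact hle _ _ _
  · intro n v w
    refine hge _ _ _ fun i => ?_
    rw [Matrix.map_mul]
    exact (OperatorAlgebra.mnorm_mul_le _ _ _).trans
      (mul_le_mul (hle _ _ _) (hle _ _ _) (apply_nonneg _ _) (h0 _ _))

/-- A quotient of an operator algebra is an operator algebra. -/
theorem OperatorAlgebra.exists_quotient {B : OAlg.{u}} {Q : NAlg.{u}}
    (p : OAlg.forgetToNAlg.obj B ⟶ Q)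
    (hp : ∀ q : Q, ∀ ε > 0, ∃ b : B, p.toAlgHom b = q ∧ ‖b‖ < ‖q‖ + ε) :
    ∃ _ : OperatorAlgebra Q, (∀ n (v : Matrix (Fin n) (Fin n) B),
      mnorm n (v.map p.toAlgHom) ≤ mnorm n v) ∧
      ∀ n (v : Matrix (Fin n) (Fin n) Q), ∀ ε > 0, ∃ w : Matrix (Fin n) (Fin n) B,
        w.map p.toAlgHom = v ∧ mnorm n w < mnorm n v + ε := by
  let ψ : B →ₐ[ℂ] Q := p.toAlgHom
  have hψ : ∀ b, ‖ψ b‖ ≤ ‖b‖ := p.contractive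
  let T : ∀ n, Matrix (Fin n) (Fin n) Q → Set ℝ := fun n v =>
    {r | ∃ w : Matrix (Fin n) (Fin n) B, w.map ψ = v ∧ mnorm n w = r}
  let N : ∀ n, Matrix (Fin n) (Fin n) Q → ℝ := fun n v => sInf (T n v)
  have hlift : ∀ n (v : Matrix (Fin n) (Fin n) Q), ∃ w : Matrix (Fin n) (Fin n) B,
      w.map ψ = v := by
    intro n v
    choose b hb _ using fun q => hp q 1 one_pos
    exact ⟨v.map b, by ext i j; exact hb _⟩
  have hne : ∀ n v, (T n v).Nonempty := fun n v => by
    obtain ⟨w, hw⟩ := hlift n v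
    exact ⟨_, w, hw, rfl⟩
  have hbd : ∀ n v, BddBelow (T n v) := fun n v =>
    ⟨0, by rintro _ ⟨w, -, rfl⟩; exact apply_nonneg _ _⟩
  have hle : ∀ n (w : Matrix (Fin n) (Fin n) B), N n (w.map ψ) ≤ mnorm n w := fun n w =>
    csInf_le (hbd _ _) ⟨w, rfl, rfl⟩
  have hge : ∀ n v (M : ℝ), (∀ w : Matrix (Fin n) (Fin n) B, w.map ψ = v → M ≤ mnorm n w) →
      M ≤ N n v := fun n v M h =>
    le_csInf (hne n v) (by rintro _ ⟨w, hw, rfl⟩; exact h w hw)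
  have hex : ∀ n v, ∀ ε > 0, ∃ w : Matrix (Fin n) (Fin n) B, w.map ψ = v ∧
      mnorm n w < N n v + ε := fun n v ε hε => by
    obtain ⟨_, ⟨w, hw, rfl⟩, h⟩ := exists_lt_of_csInf_lt (hne n v)
      (lt_add_of_pos_right (sInf (T n v)) hε)
    exact ⟨w, hw, h⟩
  have h0 : ∀ n v, 0 ≤ N n v := fun n v => hge n v 0 fun w _ => apply_nonneg _ _
  have hent : ∀ n v k l, ‖v k l‖ ≤ N n v := fun n v k l => hge n v _ fun w hw => by
    rw [← hw]
    exact (hψ _).trans (norm_entry_le w k l)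
  refine ⟨{ mnorm := fun n => Seminorm.ofSMulLE (N n) ?_ ?_ ?_
            eq_zero_of_mnorm := ?_
            mnorm_one := ?_
            mnorm_directSum := ?_
            mnorm_compress := ?_
            mnorm_mul_le := ?_ }, fun n v => hle n v, hex⟩
  · refine le_antisymm ?_ (h0 _ _)
    have := hle n 0
    rwa [Matrix.map_zero _ (map_zero _), map_zero] at this
  · intro v w
    refine le_of_forall_pos_le_add fun ε hε => ?_
    obtain ⟨a, rfl, ha⟩ := hex n v _ (half_pos hε)
    obtain ⟨b, rfl, hb⟩ := hex n w _ (half_pos hε)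
    rw [← Matrix.map_add _ (map_add _)]
    have := (hle n (a + b)).trans (map_add_le_add _ _ _)
    linarith
  · intro c v
    rcases eq_or_ne c 0 with rfl | hc
    · have := hle n 0
      rw [Matrix.map_zero _ (map_zero _), map_zero] at this
      simpa using this
    · have hc' : 0 < ‖c‖ := norm_pos_iff.2 hc
      rw [← div_le_iff₀' hc']
      refine hge _ _ _ fun w hw => ?_
      rw [div_le_iff₀' hc', ← hw, ← map_smul_eq_mul (mnorm n) c w,
        ← Matrix.map_smul _ _ (map_smul ψ c)]
      exact hle _ _
  · intro n v hv
    ext k l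
    exact norm_le_zero_iff.1 ((hent n v k l).trans_eq hv)
  · intro v
    refine le_antisymm (le_of_forall_pos_le_add fun ε hε => ?_) (hent 1 v 0 0)
    obtain ⟨b, hb, hbn⟩ := hp (v 0 0) ε hε
    have h := hle 1 (Matrix.of fun _ _ => b)
    have h1 : (Matrix.of fun _ _ => b : Matrix (Fin 1) (Fin 1) B).map ψ = v := by
      ext i j
      rw [Subsingleton.elim i 0, Subsingleton.elim j 0]
      exact hb
    rw [mnorm_one, h1] at h
    exact h.trans hbn.le
  · intro m n v w
    refine le_antisymm (le_of_forall_pos_le_add fun ε hε => ?_)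
      (max_le (hge _ _ _ fun a ha => ?_) (hge _ _ _ fun a ha => ?_))
    · obtain ⟨a, rfl, ha⟩ := hex m v _ hε
      obtain ⟨b, rfl, hb⟩ := hex n w _ hε
      have h := hle _ (Matrix.reindex finSumFinEquiv finSumFinEquiv (Matrix.fromBlocks a 0 0 b))
      rw [mnorm_directSum] at h
      simp only [Matrix.reindex_apply, ← Matrix.submatrix_map, Matrix.fromBlocks_map,
        Matrix.map_zero _ (map_zero ψ)] at h ⊢
      refine h.trans ?_
      rw [← max_add_add_right]
      exact max_le_max ha.le hb.le
    -- Any lift of the direct sum compresses to a lift of each summand.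
    · have h1 : (a.submatrix (Fin.castAdd n) (Fin.castAdd n)).map ψ = v := by
        rw [← Matrix.submatrix_map, ha]
        ext i j
        simp
      rw [← h1]
      exact (hle _ _).trans (mnorm_submatrix_le (Fin.castAdd_injective m n)
        (Fin.castAdd_injective m n) _)
    · have h1 : (a.submatrix (Fin.natAdd m) (Fin.natAdd m)).map ψ = w := by
        rw [← Matrix.submatrix_map, ha]
        ext i j
        simp
      rw [← h1]
      exact (hle _ _).trans (mnorm_submatrix_le (Fin.natAdd_injective n m)
        (Fin.natAdd_injective n m) _)
  · intro m n α v β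
    open scoped Matrix.Norms.L2Operator in
    refine le_of_forall_pos_le_add fun ε hε => ?_
    -- The error is multiplied by `‖α‖ * ‖β‖`; the added `1` keeps the denominator positive.
    obtain ⟨w, rfl, hw⟩ := hex m v (ε / (‖α‖ * ‖β‖ + 1)) (by positivity)
    have h1 : (Matrix.of fun k l => ∑ a, ∑ b, (α k a * β b l) • (w.map ψ) a b) =
        (Matrix.of fun k l => ∑ a, ∑ b, (α k a * β b l) • w a b).map ψ := by
      ext k l
      simp
    rw [h1]
    refine ((hle _ _).trans (mnorm_compress _ _ _ _ _)).trans ?_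
    have h2 : ‖α‖ * mnorm m w * ‖β‖ ≤ ‖α‖ * (N m (w.map ψ) + ε / (‖α‖ * ‖β‖ + 1)) * ‖β‖ := by
      gcongr
    have h3 : ‖α‖ * ‖β‖ * (ε / (‖α‖ * ‖β‖ + 1)) ≤ ε := by
      rw [mul_div_assoc', div_le_iff₀ (by positivity)]
      nlinarith
    refine h2.trans (le_of_eq_of_le ?_ (add_le_add_right h3 _))
    change _ = ‖α‖ * N m (w.map ψ) * ‖β‖ + _
    ring
  · intro n v w
    refine le_mul_of_forall_pos_le fun ε hε => ?_
    obtain ⟨a, rfl, ha⟩ := hex n v _ hε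
    obtain ⟨b, rfl, hb⟩ := hex n w _ hε
    rw [← Matrix.map_mul]
    refine ((hle _ _).trans (OperatorAlgebra.mnorm_mul_le _ _ _)).trans ?_
    exact mul_le_mul ha.le hb.le (apply_nonneg _ _) (add_nonneg (h0 n _) hε.le)

/-- A contractive homomorphism from a normed algebra factors through its quotient by the kernel. -/
theorem NAlg.exists_quotient_ker {B N : NAlg.{u}} (h : B ⟶ N) :
    ∃ (Q : NAlg.{u}) (p : B ⟶ Q) (j : Q ⟶ N), p ≫ j = h ∧ Function.Injective j.toAlgHom ∧
      (∀ q : Q, ∀ ε > 0, ∃ b : B, p.toAlgHom b = q ∧ ‖b‖ < ‖q‖ + ε) ∧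
      (CompleteSpace B → CompleteSpace Q) := by
  let I : Ideal B := RingHom.ker h.toAlgHom
  have hI : IsClosed (I : Set B) :=
    isClosed_singleton.preimage (NAlg.Hom.continuous h)
  have hlt : ∀ (x : B ⧸ I), ∀ ε > 0, ∃ b : B, Ideal.Quotient.mk I b = x ∧ ‖b‖ < ‖x‖ + ε :=
    fun x ε hε => Submodule.Quotient.norm_mk_lt x hε
  have hle : ∀ b : B, ‖Ideal.Quotient.mk I b‖ ≤ ‖b‖ := fun b =>
    Submodule.Quotient.norm_mk_le I b
  let _ : NormedRing (B ⧸ I) :=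
    { Ideal.Quotient.ring I, Submodule.Quotient.normedAddCommGroup I with
      norm_mul_le := fun x y => le_mul_of_forall_pos_le fun ε hε => by
        obtain ⟨a, rfl, ha⟩ := hlt x ε hε
        obtain ⟨b, rfl, hb⟩ := hlt y ε hε
        exact ((hle (a * b)).trans (norm_mul_le a b)).trans (mul_le_mul ha.le hb.le (norm_nonneg _)
          (by positivity)) }
  let _ : NormedAlgebra ℂ (B ⧸ I) :=
    { Ideal.Quotient.algebra ℂ with
      norm_smul_le := fun c x => norm_smul_le (α := ℂ) (β := B ⧸ (I : Submodule B B)) c x }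
  let k : B ⧸ I →ₐ[ℂ] N := Ideal.Quotient.liftₐ I h.toAlgHom fun a ha => ha
  have hk : ∀ x, ‖k x‖ ≤ ‖x‖ := fun x => le_of_forall_pos_le_add fun ε hε => by
    obtain ⟨b, rfl, hb⟩ := hlt x ε hε
    exact (h.contractive b).trans hb.le
  -- The lower bound `1 ≤ ‖1‖` comes from `N`, since `k` is contractive and unital.
  have _ : NormOneClass (B ⧸ I) := by
    refine ⟨le_antisymm ?_ ?_⟩
    · simpa using hle 1
    · simpa using hk 1
  refine ⟨⟨B ⧸ I⟩, ⟨Ideal.Quotient.mkₐ ℂ I, hle⟩, ⟨k, hk⟩, rfl, ?_, hlt, fun hB => ?_⟩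
  · exact RingHom.kerLift_injective (h.toAlgHom : B →+* N)
  · exact Submodule.Quotient.completeSpace (I : Submodule B B)

end

/-! ### Coequalizers and coproducts -/

section

open OperatorSpace

lemma OAlg.Hom.eq_of_forall {A B : OAlg.{u}} {f g : A ⟶ B}
    (h : ∀ x, f.toAlgHom x = g.toAlgHom x) : f = g :=
  OAlg.Hom.ext (AlgHom.ext h)

lemma OAlg.Hom.apply_congr {A B : OAlg.{u}} {f g : A ⟶ B} (h : f = g) (x : A) :
    f.toAlgHom x = g.toAlgHom x := h ▸ rfl

instance : OAlg.forgetToNAlg.{u}.Faithful where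
  map_injective h := OAlg.Hom.eq_of_forall fun x => NAlg.Hom.apply_congr h x

instance : COAlg.forgetToBanAlg.{u}.Faithful where
  map_injective {A B _ _} h := ObjectProperty.hom_ext _
    (OAlg.forgetToNAlg.map_injective (congrArg
      (fun k : COAlg.forgetToBanAlg.obj A ⟶ COAlg.forgetToBanAlg.obj B => k.hom) h))

lemma NAlg.mono_of_injective {A B : NAlg.{u}} {f : A ⟶ B} (hf : Function.Injective f.toAlgHom) :
    Mono f :=
  ⟨fun _ _ h => NAlg.Hom.eq_of_forall fun x => hf (NAlg.Hom.apply_congr h x)⟩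

lemma NAlg.epi_of_surjective {A B : NAlg.{u}} {f : A ⟶ B} (hf : Function.Surjective f.toAlgHom) :
    Epi f :=
  ⟨fun _ _ h => NAlg.Hom.eq_of_forall fun x => by
    obtain ⟨y, rfl⟩ := hf x
    exact NAlg.Hom.apply_congr h y⟩

/-- A contractive homomorphism from an operator algebra factors through an operator algebra, its
quotient by the kernel. -/
theorem OAlg.exists_quotient_ker {B : OAlg.{u}} {N : NAlg.{u}} (h : forgetToNAlg.obj B ⟶ N) :
    ∃ (Q : OAlg.{u}) (p : B ⟶ Q) (j : forgetToNAlg.obj Q ⟶ N), forgetToNAlg.map p ≫ j = h ∧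
      Function.Injective j.toAlgHom ∧ Function.Surjective p.toAlgHom ∧
      (CompleteSpace B → CompleteSpace Q) ∧
      ∀ n (v : Matrix (Fin n) (Fin n) Q), ∀ ε > 0, ∃ w : Matrix (Fin n) (Fin n) B,
        w.map p.toAlgHom = v ∧ mnorm n w < mnorm n v + ε := by
  obtain ⟨Q, p, j, hpj, hj, hp, hQ⟩ := NAlg.exists_quotient_ker h
  obtain ⟨s, hs, hs'⟩ := OperatorAlgebra.exists_quotient p hp
  exact ⟨⟨Q⟩, ⟨p.toAlgHom, hs⟩, j, hpj, hj, fun q => (hp q 1 one_pos).imp fun _ h => h.1, hQ, hs'⟩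

/-- A completely contractive homomorphism is a surjective one followed by an injective one. -/
theorem OAlg.exists_factor_ker {B Z : OAlg.{u}} (h : B ⟶ Z) :
    ∃ (Q : OAlg.{u}) (p : B ⟶ Q) (j : Q ⟶ Z), p ≫ j = h ∧
      Function.Injective j.toAlgHom ∧ Function.Surjective p.toAlgHom ∧
      (CompleteSpace B → CompleteSpace Q) := by
  obtain ⟨Q, p, j, hpj, hj, hp, hQ, hm⟩ := OAlg.exists_quotient_ker (forgetToNAlg.map h)
  have hpj' : ∀ x, j.toAlgHom (p.toAlgHom x) = h.toAlgHom x := NAlg.Hom.apply_congr hpj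
  refine ⟨Q, p, ⟨j.toAlgHom, fun n v => le_of_forall_pos_le_add fun ε hε => ?_⟩,
    OAlg.Hom.eq_of_forall hpj', hj, hp, hQ⟩
  -- A matrix over the quotient lifts to `B` with almost the same norm, and `h` does not increase
  -- that norm.
  obtain ⟨w, rfl, hw⟩ := hm n v ε hε
  have h1 : (w.map p.toAlgHom).map j.toAlgHom = w.map h.toAlgHom := by
    ext k l
    exact hpj' _
  exact (h1 ▸ OAlg.Hom.mnorm_map_le h n w).trans hw.le

/-- A faithful functor with suitable factorizations preserves coequalizers. -/
theorem preservesCoequalizers_of_factorizations {𝒞 𝒟 : Type*} [Category 𝒞] [Category 𝒟]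
    (F : 𝒞 ⥤ 𝒟) [F.Faithful]
    (h₁ : ∀ (B : 𝒞) (N : 𝒟) (h : F.obj B ⟶ N), ∃ (Q : 𝒞) (p : B ⟶ Q) (j : F.obj Q ⟶ N),
      F.map p ≫ j = h ∧ Mono j)
    (h₂ : ∀ (B Z : 𝒞) (h : B ⟶ Z), ∃ (Q : 𝒞) (p : B ⟶ Q) (j : Q ⟶ Z),
      p ≫ j = h ∧ Mono j ∧ Epi (F.map p)) :
    PreservesColimitsOfShape WalkingParallelPair F := by
  have key : ∀ {A B : 𝒞} (f g : A ⟶ B), PreservesColimit (parallelPair f g) F := by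
    intro A B f g
    refine ⟨fun {c} hc => ?_⟩
    let q : B ⟶ c.pt := Cofork.π c
    have hq : f ≫ q = g ≫ q := Cofork.condition c
    -- Factor `q` as `p ≫ j`. By universality `p` factors through `q`, which splits the monomorphism
    -- `j`. So `j` is an isomorphism, and `F.map q` is epi because `F.map p` is.
    have hepi : Epi (F.map q) := by
      obtain ⟨Q, p, j, hpj, hj, hp⟩ := h₂ _ _ q
      have hp' : f ≫ p = g ≫ p := by
        rw [← cancel_mono j, Category.assoc, Category.assoc, hpj, hq]
      obtain ⟨s, hs⟩ := Cofork.IsColimit.desc' hc p hp'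
      have hsj : s ≫ j = 𝟙 c.pt := Cofork.IsColimit.hom_ext hc (by
        have hs' : q ≫ s = p := hs
        change q ≫ s ≫ j = q ≫ 𝟙 _
        rw [← Category.assoc, hs', hpj, Category.comp_id])
      have : IsSplitEpi j := ⟨⟨⟨s, hsj⟩⟩⟩
      have : IsIso j := isIso_of_mono_of_isSplitEpi j
      rw [← hpj, F.map_comp]
      exact epi_comp _ _
    have hdesc : ∀ s : Cocone (parallelPair f g ⋙ F), ∃ k : F.obj c.pt ⟶ s.pt,
        F.map q ≫ k = s.ι.app WalkingParallelPair.one := by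
      intro s
      -- Since `j` is mono and `F` is faithful, `p` already coequalizes `f` and `g` in the source
      -- category and descends to `c.pt`.
      obtain ⟨Q, p, j, hpj, hj⟩ := h₁ _ _ (s.ι.app WalkingParallelPair.one)
      have e1 := s.w WalkingParallelPairHom.left
      have e2 := s.w WalkingParallelPairHom.right
      have hp' : f ≫ p = g ≫ p := by
        apply F.map_injective
        rw [← cancel_mono j, F.map_comp, F.map_comp, Category.assoc, Category.assoc, hpj]
        exact e1.trans e2.symm
      obtain ⟨t, ht⟩ := Cofork.IsColimit.desc' hc p hp'
      have ht' : q ≫ t = p := ht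
      exact ⟨F.map t ≫ j, by rw [← Category.assoc, ← F.map_comp, ht', hpj]⟩
    choose k hk using hdesc
    refine ⟨⟨k, fun s x => ?_, fun s m hm => ?_⟩⟩
    · have h0 : F.map (c.ι.app WalkingParallelPair.one) ≫ k s = s.ι.app WalkingParallelPair.one :=
        hk s
      rcases x with _ | _
      · rw [← s.w WalkingParallelPairHom.left, ← h0]
        change F.map (c.ι.app WalkingParallelPair.zero) ≫ k s = F.map f ≫ _
        rw [← c.w WalkingParallelPairHom.left, F.map_comp, Category.assoc]
        rfl
      · exact h0
    · rw [← cancel_epi (F.map q), hk]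
      exact hm WalkingParallelPair.one
  exact ⟨fun {K} => by
    have := key (K.map WalkingParallelPairHom.left) (K.map WalkingParallelPairHom.right)
    exact preservesColimit_of_iso_diagram F (diagramIsoParallelPair K).symm⟩

theorem OAlg.preservesCoequalizers_forget :
    PreservesColimitsOfShape WalkingParallelPair OAlg.forgetToNAlg.{u} := by
  refine preservesCoequalizers_of_factorizations _ (fun B N h => ?_) fun B Z h => ?_
  · obtain ⟨Q, p, j, hpj, hj, -⟩ := OAlg.exists_quotient_ker h
    exact ⟨Q, p, j, hpj, NAlg.mono_of_injective hj⟩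
  · obtain ⟨Q, p, j, hpj, hj, hp, -⟩ := OAlg.exists_factor_ker h
    exact ⟨Q, p, j, hpj, forgetToNAlg.mono_of_mono_map (NAlg.mono_of_injective hj),
      NAlg.epi_of_surjective hp⟩

theorem BanAlg.mono_of_injective {A B : BanAlg.{u}} {f : A ⟶ B}
    (hf : Function.Injective (BanAlg.fn f)) : Mono f :=
  (NAlg.IsBanach.ι).mono_of_mono_map (NAlg.mono_of_injective hf)

theorem BanAlg.epi_of_surjective {A B : BanAlg.{u}} {f : A ⟶ B}
    (hf : Function.Surjective (BanAlg.fn f)) : Epi f :=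
  (NAlg.IsBanach.ι).epi_of_epi_map (NAlg.epi_of_surjective hf)

/-- A contractive homomorphism from a complete operator algebra factors through a complete operator
algebra, its quotient by the kernel. -/
theorem COAlg.exists_quotient_ker {B : COAlg.{u}} {N : BanAlg.{u}}
    (h : COAlg.forgetToBanAlg.obj B ⟶ N) :
    ∃ (Q : COAlg.{u}) (p : B ⟶ Q) (j : COAlg.forgetToBanAlg.obj Q ⟶ N),
      COAlg.forgetToBanAlg.map p ≫ j = h ∧ Function.Injective (BanAlg.fn j) ∧
      Function.Surjective (COAlg.fn p) := by
  obtain ⟨Q, p, j, hpj, hj, hp, hQ, -⟩ := OAlg.exists_quotient_ker h.hom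
  exact ⟨⟨Q, hQ B.property⟩, ObjectProperty.homMk p, ObjectProperty.homMk j,
    ObjectProperty.hom_ext _ hpj, hj, hp⟩

theorem COAlg.exists_factor_ker {B Z : COAlg.{u}} (h : B ⟶ Z) :
    ∃ (Q : COAlg.{u}) (p : B ⟶ Q) (j : Q ⟶ Z), p ≫ j = h ∧
      Function.Injective (COAlg.fn j) ∧ Function.Surjective (COAlg.fn p) := by
  obtain ⟨Q, p, j, hpj, hj, hp, hQ⟩ := OAlg.exists_factor_ker h.hom
  exact ⟨⟨Q, hQ B.property⟩, ObjectProperty.homMk p, ObjectProperty.homMk j,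
    ObjectProperty.hom_ext _ hpj, hj, hp⟩

theorem COAlg.preservesCoequalizers_forget :
    PreservesColimitsOfShape WalkingParallelPair COAlg.forgetToBanAlg.{u} := by
  refine preservesCoequalizers_of_factorizations _ (fun B N h => ?_) fun B Z h => ?_
  · obtain ⟨Q, p, j, hpj, hj, -⟩ := COAlg.exists_quotient_ker h
    exact ⟨Q, p, j, hpj, BanAlg.mono_of_injective hj⟩
  · obtain ⟨Q, p, j, hpj, hj, hp⟩ := COAlg.exists_factor_ker h
    exact ⟨Q, p, j, hpj, forgetToBanAlg.mono_of_mono_map (BanAlg.mono_of_injective hj),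
      BanAlg.epi_of_surjective hp⟩

/-! ### Existence of coproducts -/

/-- Two operator algebras have a coproduct, if they map to a common one. -/
theorem OAlg.exists_coproduct {𝒦 : ObjectProperty OAlg.{u}} (h𝒦 : 𝒦 = ⊤ ∨ 𝒦 = OAlg.IsComplete)
    {A B C₀ : OAlg.{u}} (hC₀ : 𝒦 C₀) (f₀ : A ⟶ C₀) (g₀ : B ⟶ C₀) :
    ∃ (E : OAlg.{u}) (inl : A ⟶ E) (inr : B ⟶ E), 𝒦 E ∧ ∀ C, 𝒦 C → ∀ (f : A ⟶ C) (g : B ⟶ C),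
      ∃! k : E ⟶ C, inl ≫ k = f ∧ inr ≫ k = g := by
  obtain ⟨𝒦', h𝒦', hK⟩ : ∃ 𝒦' : ObjectProperty NAlg.{u}, (𝒦' = ⊤ ∨ 𝒦' = NAlg.IsBanach) ∧
      ∀ C, 𝒦' (forgetToNAlg.obj C) ↔ 𝒦 C := by
    rcases h𝒦 with rfl | rfl
    · exact ⟨⊤, Or.inl rfl, fun C => Iff.rfl⟩
    · exact ⟨NAlg.IsBanach, Or.inr rfl, fun C => Iff.rfl⟩
  -- All pairs of morphisms to objects of `𝒦` are admitted. The index type lies in a larger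
  -- universe, but enters the object `E` only through suprema of real numbers.
  let ι := {x : Σ C : OAlg.{u}, (A ⟶ C) × (B ⟶ C) // 𝒦 x.1}
  have : Nonempty ι := ⟨⟨⟨C₀, f₀, g₀⟩, hC₀⟩⟩
  obtain ⟨E, inl, inr, φ, hE, hl, hr, hn, hu⟩ := NAlg.exists_joint h𝒦'
    (A := forgetToNAlg.obj A) (B := forgetToNAlg.obj B)
    (fun i : ι => forgetToNAlg.obj i.1.1) (fun i => (hK _).2 i.2)
    (fun i => forgetToNAlg.map i.1.2.1) (fun i => forgetToNAlg.map i.1.2.2)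
  obtain ⟨inst, h1, h2⟩ := OperatorAlgebra.exists_joint (fun i : ι => i.1.1) φ hn
  have hcc : ∀ (A : OAlg.{u}) (t : forgetToNAlg.obj A ⟶ E) (f : ∀ i : ι, A ⟶ i.1.1)
      (_ : ∀ i, t ≫ φ i = forgetToNAlg.map (f i)) (n : ℕ) (a : Matrix (Fin n) (Fin n) A),
      mnorm (V := E) n (a.map t.toAlgHom) ≤ mnorm n a := by
    intro A t f ht n a
    refine h2 n _ _ fun i => ?_
    have : (a.map t.toAlgHom).map (φ i).toAlgHom = a.map (f i).toAlgHom := by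
      ext k l
      exact NAlg.Hom.apply_congr (ht i) _
    exact (congrArg (mnorm (V := i.1.1) n) this).trans_le (OAlg.Hom.mnorm_map_le (f i) n a)
  refine ⟨⟨E⟩, ⟨inl.toAlgHom, hcc A inl (fun i => i.1.2.1) hl⟩,
    ⟨inr.toAlgHom, hcc B inr (fun i => i.1.2.2) hr⟩, (hK ⟨E⟩).1 hE, fun C hC f g => ?_⟩
  let i : ι := ⟨⟨C, f, g⟩, hC⟩
  refine ⟨⟨(φ i).toAlgHom, h1 i⟩, ⟨?_, ?_⟩, fun k hk => ?_⟩
  · exact OAlg.Hom.eq_of_forall (NAlg.Hom.apply_congr (hl i))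
  · exact OAlg.Hom.eq_of_forall (NAlg.Hom.apply_congr (hr i))
  · refine forgetToNAlg.map_injective (hu _ (forgetToNAlg.map k) (φ i) ?_ ?_)
    · rw [hl]
      exact NAlg.Hom.eq_of_forall (OAlg.Hom.apply_congr hk.1)
    · rw [hr]
      exact NAlg.Hom.eq_of_forall (OAlg.Hom.apply_congr hk.2)

theorem hasBinaryCoproduct_of_existsUnique {𝒞 : Type*} [Category 𝒞] {A B E : 𝒞} (inl : A ⟶ E)
    (inr : B ⟶ E) (h : ∀ (C : 𝒞) (f : A ⟶ C) (g : B ⟶ C), ∃! k : E ⟶ C, inl ≫ k = f ∧ inr ≫ k = g) :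
    HasBinaryCoproduct A B :=
  ⟨⟨BinaryCofan.mk inl inr, BinaryCofan.IsColimit.mk _
    (fun f g => (h _ f g).choose) (fun f g => (h _ f g).choose_spec.1.1)
    (fun f g => (h _ f g).choose_spec.1.2)
    fun f g m hl hr => (h _ f g).choose_spec.2 m ⟨hl, hr⟩⟩⟩

theorem OAlg.hasBinaryCoproduct_self (A : OAlg.{u}) : HasBinaryCoproduct A A := by
  obtain ⟨E, inl, inr, -, h⟩ := OAlg.exists_coproduct (𝒦 := ⊤) (Or.inl rfl) trivial (𝟙 A) (𝟙 A)
  exact hasBinaryCoproduct_of_existsUnique inl inr fun C => h C trivial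

theorem COAlg.hasBinaryCoproduct_self (A : COAlg.{u}) : HasBinaryCoproduct A A := by
  obtain ⟨E, inl, inr, hE, h⟩ := OAlg.exists_coproduct (Or.inr rfl) A.property (𝟙 A.obj) (𝟙 A.obj)
  refine hasBinaryCoproduct_of_existsUnique (E := ⟨E, hE⟩) (ObjectProperty.homMk inl)
    (ObjectProperty.homMk inr) fun C f g => ?_
  obtain ⟨k, ⟨hl, hr⟩, hk⟩ := h C.obj C.property f.hom g.hom
  exact ⟨ObjectProperty.homMk k, ⟨ObjectProperty.hom_ext _ hl, ObjectProperty.hom_ext _ hr⟩,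
    fun m hm => ObjectProperty.hom_ext _ (hk m.hom
      ⟨congrArg InducedCategory.Hom.hom hm.1, congrArg InducedCategory.Hom.hom hm.2⟩)⟩

theorem BanAlg.hasBinaryCoproduct_self (A : BanAlg.{u}) : HasBinaryCoproduct A A := by
  let ι := Σ C : BanAlg.{u}, (A ⟶ C) × (A ⟶ C)
  have : Nonempty ι := ⟨⟨A, 𝟙 A, 𝟙 A⟩⟩
  obtain ⟨E, inl, inr, φ, hE, hl, hr, -, hu⟩ := NAlg.exists_joint (Or.inr rfl)
    (fun i : ι => i.1.obj) (fun i => i.1.property) (fun i => i.2.1.hom) (fun i => i.2.2.hom)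
  refine hasBinaryCoproduct_of_existsUnique (E := ⟨E, hE⟩) (ObjectProperty.homMk inl)
    (ObjectProperty.homMk inr) fun C f g => ?_
  refine ⟨ObjectProperty.homMk (φ ⟨C, f, g⟩), ⟨ObjectProperty.hom_ext _ (hl ⟨C, f, g⟩),
    ObjectProperty.hom_ext _ (hr ⟨C, f, g⟩)⟩, fun m hm => ObjectProperty.hom_ext _ (hu _ _ _ ?_ ?_)⟩
  · exact (congrArg InducedCategory.Hom.hom hm.1).trans (hl ⟨C, f, g⟩).symm
  · exact (congrArg InducedCategory.Hom.hom hm.2).trans (hr ⟨C, f, g⟩).symm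

end

/-! ### Homomorphisms on tensor products -/

namespace ProjTensor

variable {A B : Type u} [NormedCommRing A] [NormedAlgebra ℂ A] [NormedCommRing B]
  [NormedAlgebra ℂ B]

lemma induction_on {P : ProjTensor A B → Prop} (t : ProjTensor A B)
    (htmul : ∀ a b, P (tmul a b)) (hadd : ∀ s t, P s → P t → P (s + t)) : P t := by
  induction t using TensorProduct.induction_on with
  | zero =>
    have h : tmul (0 : A) (0 : B) = 0 := TensorProduct.zero_tmul _ _
    exact h ▸ htmul 0 0
  | tmul a b => exact htmul a b
  | add s t hs ht => exact hadd s t hs ht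

/-- The homomorphism on the tensor product given by two commuting homomorphisms. -/
noncomputable def lift {C : Type*} [Ring C] [Algebra ℂ C] (f : A →ₐ[ℂ] C) (g : B →ₐ[ℂ] C)
    (h : ∀ a b, Commute (f a) (g b)) : ProjTensor A B →ₐ[ℂ] C :=
  (Algebra.TensorProduct.lift f g h : A ⊗[ℂ] B →ₐ[ℂ] C)

lemma lift_tmul {C : Type*} [Ring C] [Algebra ℂ C] (f : A →ₐ[ℂ] C) (g : B →ₐ[ℂ] C)
    (h : ∀ a b, Commute (f a) (g b)) (a : A) (b : B) : lift f g h (tmul a b) = f a * g b :=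
  Algebra.TensorProduct.lift_tmul f g h a b

/-- The projective norm is an infimum of costs of representations, so a bound on elementary tensors
extends by the triangle inequality. -/
lemma norm_le_of_tmul {C : Type*} [SeminormedAddCommGroup C] (G : ProjTensor A B →+ C) {M : ℝ}
    (hM : 0 ≤ M) (hG : ∀ a b, ‖G (tmul a b)‖ ≤ M * (‖a‖ * ‖b‖)) (t : ProjTensor A B) :
    ‖G t‖ ≤ M * ‖t‖ := by
  have h : ∀ r ∈ costs t, ‖G t‖ ≤ M * r := by
    rintro _ ⟨l, rfl, rfl⟩
    induction l with
    | nil => simp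
    | cons x l ih =>
      simp only [List.map_cons, List.sum_cons, map_add, mul_add]
      exact (norm_add_le _ _).trans (add_le_add (hG _ _) ih)
  refine le_of_forall_pos_le_add fun ε hε => ?_
  obtain ⟨r, hr, hr'⟩ := exists_cost_lt t (ε := ε / (M + 1)) (by positivity)
  have h1 : M * (ε / (M + 1)) ≤ ε := by
    rw [mul_div_assoc', div_le_iff₀ (by positivity)]
    nlinarith
  calc ‖G t‖ ≤ M * r := h r hr
    _ ≤ M * (‖t‖ + ε / (M + 1)) := by
        gcongr
        exact hr'.le
    _ ≤ M * ‖t‖ + ε := by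
        rw [mul_add]
        gcongr

lemma norm_lift_le {C : Type*} [NormedRing C] [NormedAlgebra ℂ C] (f : A →ₐ[ℂ] C)
    (g : B →ₐ[ℂ] C) (h : ∀ a b, Commute (f a) (g b)) (hf : ∀ a, ‖f a‖ ≤ ‖a‖)
    (hg : ∀ b, ‖g b‖ ≤ ‖b‖) (t : ProjTensor A B) : ‖lift f g h t‖ ≤ ‖t‖ := by
  have := norm_le_of_tmul (lift f g h : ProjTensor A B →+ C) zero_le_one (fun a b => by
    rw [one_mul]
    refine (congrArg norm (lift_tmul f g h a b)).trans_le ((norm_mul_le _ _).trans ?_)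
    exact mul_le_mul (hf a) (hg b) (norm_nonneg _) (norm_nonneg _)) t
  simpa using this

end ProjTensor

/-! ### Functions on a product -/

open Filter Topology

/-- A compact metric space has fine partitions of unity consisting of squares. -/
theorem exists_sq_partition (X : Type u) [PseudoMetricSpace X] [CompactSpace X] {δ : ℝ}
    (hδ : 0 < δ) : ∃ (K : ℕ) (p : Fin K → C(X, ℂ)) (z : Fin K → X),
      (∀ x, ∑ k, ‖p k x‖ ^ 2 = 1) ∧ (∀ k x, star (p k x) = p k x) ∧
      ∀ k x, p k x ≠ 0 → dist x (z k) < δ := by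
  obtain ⟨t, -, ht, hcov⟩ := Metric.finite_approx_of_totallyBounded (isCompact_univ (X := X)).totallyBounded δ hδ
  have := ht.fintype
  let e := Fintype.equivFin t
  let z : Fin (Fintype.card t) → X := fun k => e.symm k
  -- Tents over a finite `δ`-net, to be divided by the root of the sum of their squares.
  let w : Fin (Fintype.card t) → X → ℝ := fun k x => max 0 (δ - dist x (z k))
  have hw : ∀ k, Continuous (w k) := fun k => by fun_prop
  have hw0 : ∀ k x, 0 ≤ w k x := fun k x => le_max_left _ _
  have hpos : ∀ x, 0 < ∑ k, w k x ^ 2 := fun x => by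
    have hx := hcov (Set.mem_univ x)
    simp only [Set.mem_iUnion, Metric.mem_ball] at hx
    obtain ⟨y, hy, hxy⟩ := hx
    refine Finset.sum_pos' (fun k _ => by positivity) ⟨e ⟨y, hy⟩, Finset.mem_univ _, ?_⟩
    have : 0 < w (e ⟨y, hy⟩) x := lt_max_of_lt_right (by simpa [z] using hxy)
    positivity
  have hsq : ∀ x, 0 < √(∑ k, w k x ^ 2) := fun x => Real.sqrt_pos.2 (hpos x)
  have hc : ∀ k, Continuous fun x => w k x / √(∑ k, w k x ^ 2) := fun k =>
    (hw k).div (by fun_prop) fun x => (hsq x).ne'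
  refine ⟨_, fun k => ⟨fun x => ((w k x / √(∑ k, w k x ^ 2) : ℝ) : ℂ),
    Complex.continuous_ofReal.comp (hc k)⟩, z, fun x => ?_, fun k x => Complex.conj_ofReal _,
    fun k x hx => ?_⟩
  · simp only [ContinuousMap.coe_mk, Complex.norm_real, Real.norm_eq_abs, sq_abs, div_pow]
    rw [← Finset.sum_div, Real.sq_sqrt (hpos x).le, div_self (hpos x).ne']
  · by_contra! h
    refine hx ?_
    have : w k x = 0 := max_eq_left (by linarith)
    simp [this]

/-- If the squares of `p` form a partition of unity, then averaging values close to `c` gives a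
value close to `c`. -/
lemma norm_sub_sum_sq_le {K : Type*} [Fintype K] (p : K → ℂ) (hp : ∑ k, ‖p k‖ ^ 2 = 1)
    (hreal : ∀ k, star (p k) = p k) (a : K → ℂ) (c : ℂ) {ε : ℝ}
    (h : ∀ k, p k ≠ 0 → ‖c - a k‖ ≤ ε) : ‖c - ∑ k, a k * (p k * p k)‖ ≤ ε := by
  -- As `p k` is real, its square is the nonnegative weight `‖p k‖ ^ 2`.
  have hpp : ∀ k, p k * p k = ((‖p k‖ ^ 2 : ℝ) : ℂ) := fun k => by
    have h1 := Complex.mul_conj (p k)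
    rw [Complex.normSq_eq_norm_sq] at h1
    rw [← h1]
    congr 1
    exact (hreal k).symm
  have h1 : c = ∑ k, c * (p k * p k) := by
    rw [← Finset.mul_sum]
    simp only [hpp]
    rw [← Complex.ofReal_sum, hp, Complex.ofReal_one, mul_one]
  have h2 : c - ∑ k, a k * (p k * p k) = ∑ k, (c - a k) * (p k * p k) := by
    simp only [sub_mul, Finset.sum_sub_distrib, ← h1]
  rw [h2]
  calc ‖∑ k, (c - a k) * (p k * p k)‖ ≤ ∑ k, ε * ‖p k‖ ^ 2 := by
        refine (norm_sum_le _ _).trans (Finset.sum_le_sum fun k _ => ?_)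
        rw [norm_mul, norm_mul, ← sq]
        by_cases hk : p k = 0
        · simp [hk]
        · gcongr
          exact h k hk
    _ = ε := by rw [← Finset.mul_sum, hp, mul_one]

section

variable (X Y : Type u) [PseudoMetricSpace X] [CompactSpace X] [PseudoMetricSpace Y]
  [CompactSpace Y]

/-- The canonical map from the tensor product of `C(X)` and `C(Y)` to `C(X × Y)`. -/
noncomputable def tensorToProd : ProjTensor C(X, ℂ) C(Y, ℂ) →ₐ[ℂ] C(X × Y, ℂ) :=
  ProjTensor.lift (ContinuousMap.compRightAlgHom ℂ ℂ ContinuousMap.fst)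
    (ContinuousMap.compRightAlgHom ℂ ℂ ContinuousMap.snd) fun _ _ => Commute.all _ _

variable {X Y}

lemma tensorToProd_tmul (f : C(X, ℂ)) (g : C(Y, ℂ)) :
    tensorToProd X Y (ProjTensor.tmul f g) =
      f.comp ContinuousMap.fst * g.comp ContinuousMap.snd :=
  ProjTensor.lift_tmul _ _ _ f g

lemma norm_comp_fst_le (f : C(X, ℂ)) :
    ‖f.comp (ContinuousMap.fst : C(X × Y, X))‖ ≤ ‖f‖ :=
  (ContinuousMap.norm_le _ (norm_nonneg _)).2 fun x => f.norm_coe_le_norm x.1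

lemma norm_comp_snd_le (f : C(Y, ℂ)) :
    ‖f.comp (ContinuousMap.snd : C(X × Y, Y))‖ ≤ ‖f‖ :=
  (ContinuousMap.norm_le _ (norm_nonneg _)).2 fun x => f.norm_coe_le_norm x.2

/-- A sequence of partitions of unity consisting of squares whose mesh tends to `0`. -/
structure SqPartitions (X : Type u) [PseudoMetricSpace X] where
  card : ℕ → ℕ
  fn : ∀ n, Fin (card n) → C(X, ℂ)
  pt : ∀ n, Fin (card n) → X
  sum_sq : ∀ n x, ∑ k, ‖fn n k x‖ ^ 2 = 1
  star_fn : ∀ n k x, star (fn n k x) = fn n k x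
  dist_lt : ∀ n k x, fn n k x ≠ 0 → dist x (pt n k) < 1 / ((n : ℝ) + 1)

variable (X) in
lemma SqPartitions.nonempty : Nonempty (SqPartitions X) := by
  choose K p z h1 h2 h3 using fun n : ℕ =>
    exists_sq_partition X (δ := 1 / ((n : ℝ) + 1)) (by positivity)
  exact ⟨⟨K, p, z, h1, h2, h3⟩⟩

/-- Interpolation along a partition of unity converges uniformly. -/
lemma SqPartitions.tendsto (P : SqPartitions X) (a : C(X, ℂ)) :
    Tendsto (fun n => ∑ k, a (P.pt n k) • (P.fn n k * P.fn n k)) atTop (𝓝 a) := by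
  rw [Metric.tendsto_atTop]
  intro ε hε
  obtain ⟨δ, hδ, hδ'⟩ := Metric.uniformContinuous_iff.1
    (CompactSpace.uniformContinuous_of_continuous a.continuous) (ε / 2) (half_pos hε)
  obtain ⟨N, hN⟩ := exists_nat_one_div_lt hδ
  refine ⟨N, fun n hn => ?_⟩
  rw [dist_eq_norm, norm_sub_rev]
  refine lt_of_le_of_lt ((ContinuousMap.norm_le _ (half_pos hε).le).2 fun x => ?_)
    (half_lt_self hε)
  have h := norm_sub_sum_sq_le (fun k => P.fn n k x) (P.sum_sq n x) (fun k => P.star_fn n k x)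
    (fun k => a (P.pt n k)) (a x) (ε := ε / 2) fun k hk => by
      have h1 := hδ' ((P.dist_lt n k x hk).trans_le
        ((one_div_le_one_div_of_le (by positivity) (by gcongr)).trans hN.le))
      rw [dist_eq_norm] at h1
      exact h1.le
  simpa using h

/-- Interpolation along two partitions of unity converges uniformly. -/
lemma SqPartitions.tendsto_prod (P : SqPartitions X) (Q : SqPartitions Y) (F : C(X × Y, ℂ)) :
    Tendsto (fun n => tensorToProd X Y (∑ k, ∑ l, F (P.pt n k, Q.pt n l) •
      ProjTensor.tmul (P.fn n k * P.fn n k) (Q.fn n l * Q.fn n l))) atTop (𝓝 F) := by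
  rw [Metric.tendsto_atTop]
  intro ε hε
  obtain ⟨δ, hδ, hδ'⟩ := Metric.uniformContinuous_iff.1
    (CompactSpace.uniformContinuous_of_continuous F.continuous) (ε / 2) (half_pos hε)
  obtain ⟨N, hN⟩ := exists_nat_one_div_lt hδ
  refine ⟨N, fun n hn => ?_⟩
  have hn' : 1 / ((n : ℝ) + 1) < δ :=
    (one_div_le_one_div_of_le (by positivity) (by gcongr)).trans_lt hN
  rw [dist_eq_norm, norm_sub_rev]
  refine lt_of_le_of_lt ((ContinuousMap.norm_le _ (half_pos hε).le).2 fun x => ?_)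
    (half_lt_self hε)
  -- The products of the two partitions form such a partition on `X × Y`, of the same mesh for the
  -- maximum distance.
  have h := norm_sub_sum_sq_le (K := Fin (P.card n) × Fin (Q.card n))
    (fun k => P.fn n k.1 x.1 * Q.fn n k.2 x.2)
    (by simp only [norm_mul, mul_pow, Fintype.sum_prod_type, ← Finset.mul_sum, Q.sum_sq, mul_one,
          P.sum_sq])
    (fun k => by rw [star_mul', P.star_fn, Q.star_fn])
    (fun k => F (P.pt n k.1, Q.pt n k.2)) (F x) (ε := ε / 2) fun k hk => by
      have h1 := hδ' (a := x) (b := (P.pt n k.1, Q.pt n k.2)) (max_lt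
        ((P.dist_lt n k.1 x.1 (left_ne_zero_of_mul hk)).trans hn')
        ((Q.dist_lt n k.2 x.2 (right_ne_zero_of_mul hk)).trans hn'))
      rw [dist_eq_norm] at h1
      exact h1.le
  refine le_of_eq_of_le ?_ h
  congr 1
  simp only [map_sum, map_smul, tensorToProd_tmul, ContinuousMap.sub_apply, ContinuousMap.sum_apply,
    ContinuousMap.smul_apply, ContinuousMap.mul_apply, ContinuousMap.comp_apply, smul_eq_mul,
    Fintype.sum_prod_type]
  congr 1
  refine Finset.sum_congr rfl fun k _ => Finset.sum_congr rfl fun l _ => ?_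
  change _ * (P.fn n k x.1 * P.fn n k x.1 * (Q.fn n l x.2 * Q.fn n l x.2)) = _
  ring

/-- The interpolants of a function on the product are themselves images of tensors. -/
lemma denseRange_tensorToProd : DenseRange (tensorToProd X Y) := by
  obtain ⟨P⟩ := SqPartitions.nonempty X
  obtain ⟨Q⟩ := SqPartitions.nonempty Y
  exact fun F => mem_closure_of_tendsto (P.tendsto_prod Q F) (Eventually.of_forall fun n => ⟨_, rfl⟩)

variable [Nonempty X] [Nonempty Y]

open OperatorSpace

-- Scalar matrices come from constant matrices over `C(X)`, whose supremum norm is at most their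
-- operator norm, and `f` is completely contractive.
open scoped Matrix.Norms.L2Operator in
lemma OAlg.mnorm_scalar_le {C : OAlg.{u}} (f : OAlg.ofSpace X ⟶ C) {n : ℕ}
    (M : Matrix (Fin n) (Fin n) ℂ) : mnorm n (M.map (algebraMap ℂ C)) ≤ ‖M‖ := by
  have h := OAlg.Hom.mnorm_map_le f n (M.map (algebraMap ℂ C(X, ℂ)))
  have h1 : (M.map (algebraMap ℂ C(X, ℂ))).map f.toAlgHom = M.map (algebraMap ℂ C) := by
    ext i j
    exact f.toAlgHom.commutes _
  rw [h1] at h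
  refine h.trans (supMatrixNorm_le X n _ (norm_nonneg _) fun x => ?_)
  refine le_of_eq (congrArg norm ?_)
  ext i j
  simp

/-- Interpolation in a commutative operator algebra is completely contractive. -/
lemma OAlg.mnorm_interpolate_le {C : OAlg.{u}} (hC : ∀ x y : C, x * y = y * x)
    (f : OAlg.ofSpace X ⟶ C) (g : OAlg.ofSpace Y ⟶ C) (P : SqPartitions X) (Q : SqPartitions Y)
    (m : ℕ) {n : ℕ} (F : Matrix (Fin n) (Fin n) C(X × Y, ℂ)) :
    mnorm n (Matrix.of fun i j => ∑ k, ∑ l, F i j (P.pt m k, Q.pt m l) •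
      (f.toAlgHom (P.fn m k * P.fn m k) * g.toAlgHom (Q.fn m l * Q.fn m l))) ≤
      supMatrixNorm (X × Y) n F := by
  have h0 := supMatrixNorm_nonneg (X × Y) n F
  -- The compression estimate is used twice: on the scalar matrices of values, with the partition on
  -- `Y`, and then on the results, with the partition on `X`.
  have h1 := fun k => OperatorAlgebra.mnorm_sum_conj_le g (Q.fn m) (fun y => (Q.sum_sq m y).le)
    (Q.star_fn m) (fun l => (F.map fun h => h (P.pt m k, Q.pt m l)).map (algebraMap ℂ C)) h0
    fun l => (OAlg.mnorm_scalar_le f _).trans (le_supMatrixNorm _ _ _ _)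
  have h2 := OperatorAlgebra.mnorm_sum_conj_le f (P.fn m) (fun x => (P.sum_sq m x).le)
    (P.star_fn m) _ h0 h1
  refine le_of_eq_of_le (congrArg _ ?_) h2
  ext i j
  simp only [Matrix.of_apply, Matrix.map_apply, Finset.mul_sum, Finset.sum_mul, map_mul]
  refine Finset.sum_congr rfl fun k _ => Finset.sum_congr rfl fun l _ => ?_
  rw [Algebra.smul_def, Algebra.commutes]
  set a := f.toAlgHom (P.fn m k)
  set b := g.toAlgHom (Q.fn m l)
  set c := algebraMap ℂ C (F i j (P.pt m k, Q.pt m l))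
  -- Commutativity of `C` rewrites the weight `a² b²` in the nested form that the compression
  -- estimate bounds.
  calc a * a * (b * b) * c = a * (a * (b * (b * c))) := by simp only [mul_assoc]
    _ = a * (a * (b * (c * b))) := by rw [hC b c]
    _ = a * (b * (c * b) * a) := by rw [hC a (b * (c * b))]
    _ = a * (b * c * b) * a := by simp only [mul_assoc]

/-- The homomorphism on the tensor product given by two homomorphisms into a commutative operator
algebra. -/
noncomputable def OAlg.tensorLift {C : OAlg.{u}} (hC : ∀ x y : C, x * y = y * x)
    (f : OAlg.ofSpace X ⟶ C) (g : OAlg.ofSpace Y ⟶ C) : ProjTensor C(X, ℂ) C(Y, ℂ) →ₐ[ℂ] C :=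
  ProjTensor.lift (A := C(X, ℂ)) (B := C(Y, ℂ)) f.toAlgHom g.toAlgHom fun a b =>
    (hC (f.toAlgHom a) (g.toAlgHom b) : Commute _ _)

lemma OAlg.tensorLift_tmul {C : OAlg.{u}} (hC : ∀ x y : C, x * y = y * x)
    (f : OAlg.ofSpace X ⟶ C) (g : OAlg.ofSpace Y ⟶ C) (a : C(X, ℂ)) (b : C(Y, ℂ)) :
    OAlg.tensorLift hC f g (ProjTensor.tmul a b) = f.toAlgHom a * g.toAlgHom b :=
  ProjTensor.lift_tmul (A := C(X, ℂ)) (B := C(Y, ℂ)) _ _ _ a b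

/-- Two completely contractive homomorphisms into a commutative operator algebra are jointly
dominated by the supremum norms on the product. -/
theorem OAlg.mnorm_lift_le {C : OAlg.{u}} (hC : ∀ x y : C, x * y = y * x)
    (f : OAlg.ofSpace X ⟶ C) (g : OAlg.ofSpace Y ⟶ C) {n : ℕ}
    (t : Matrix (Fin n) (Fin n) (ProjTensor C(X, ℂ) C(Y, ℂ))) :
    mnorm n (t.map (OAlg.tensorLift hC f g)) ≤
      supMatrixNorm (X × Y) n (t.map (tensorToProd X Y)) := by
  obtain ⟨P⟩ := SqPartitions.nonempty X
  obtain ⟨Q⟩ := SqPartitions.nonempty Y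
  set G := OAlg.tensorLift hC f g with hG
  -- `T m` is completely contractive on all of `C(X × Y)`. On images of tensors it converges to `G`,
  -- by continuity of `f` and `g`, so the bound survives in the limit.
  let T : ℕ → C(X × Y, ℂ) → C := fun m F => ∑ k, ∑ l, F (P.pt m k, Q.pt m l) •
      (f.toAlgHom (P.fn m k * P.fn m k) * g.toAlgHom (Q.fn m l * Q.fn m l))
  have hT : ∀ s, Tendsto (fun m => T m (tensorToProd X Y s)) atTop (𝓝 (G s)) := by
    intro s
    induction s using ProjTensor.induction_on with
    | htmul a b =>
      have hf : Continuous f.toAlgHom := NAlg.Hom.continuous (OAlg.forgetToNAlg.map f)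
      have hg : Continuous g.toAlgHom := NAlg.Hom.continuous (OAlg.forgetToNAlg.map g)
      have h := ((hf.tendsto a).comp (P.tendsto a)).mul ((hg.tendsto b).comp (Q.tendsto b))
      rw [hG, OAlg.tensorLift_tmul]
      refine h.congr fun m => ?_
      simp only [Function.comp_apply, map_sum, map_smul, Finset.sum_mul_sum, smul_mul_smul_comm, T,
        tensorToProd_tmul]
      rfl
    | hadd s t hs ht =>
      rw [map_add G]
      refine (hs.add ht).congr fun m => ?_
      simp only [T, map_add, ContinuousMap.add_apply, add_smul, Finset.sum_add_distrib]
  have hb : ∀ m, mnorm n (t.map G) ≤ supMatrixNorm (X × Y) n (t.map (tensorToProd X Y)) +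
      ∑ i, ∑ j, ‖G (t i j) - T m (tensorToProd X Y (t i j))‖ := by
    intro m
    have h1 := OAlg.mnorm_interpolate_le hC f g P Q m (t.map (tensorToProd X Y))
    set W : Matrix (Fin n) (Fin n) C := Matrix.of fun i j => T m (tensorToProd X Y (t i j)) with hW
    have h2 : mnorm n W ≤ supMatrixNorm (X × Y) n (t.map (tensorToProd X Y)) := h1
    have h3 := map_add_le_add (mnorm n) W (t.map G - W)
    rw [add_sub_cancel] at h3
    exact h3.trans (add_le_add h2 (mnorm_le_sum _))
  refine ge_of_tendsto (x := atTop) (f := fun m => supMatrixNorm (X × Y) n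
    (t.map (tensorToProd X Y)) + ∑ i, ∑ j, ‖G (t i j) - T m (tensorToProd X Y (t i j))‖) ?_
    (Eventually.of_forall hb)
  have h4 : Tendsto (fun m => ∑ i, ∑ j, ‖G (t i j) - T m (tensorToProd X Y (t i j))‖) atTop
      (𝓝 (∑ i : Fin n, ∑ j : Fin n, 0)) := by
    refine tendsto_finsetSum _ fun i _ => tendsto_finsetSum _ fun j _ => ?_
    have := (tendsto_const_nhds (x := G (t i j))).sub (hT (t i j))
    rw [sub_self] at this
    simpa using this.norm
  simpa using h4.const_add (supMatrixNorm (X × Y) n (t.map (tensorToProd X Y)))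

theorem OAlg.norm_lift_le {C : OAlg.{u}} (hC : ∀ x y : C, x * y = y * x)
    (f : OAlg.ofSpace X ⟶ C) (g : OAlg.ofSpace Y ⟶ C) (t : ProjTensor C(X, ℂ) C(Y, ℂ)) :
    ‖OAlg.tensorLift hC f g t‖ ≤ ‖tensorToProd X Y t‖ := by
  have h := OAlg.mnorm_lift_le hC f g (Matrix.of fun _ _ : Fin 1 => t)
  rw [mnorm_one, supMatrixNorm_one] at h
  exact h

/-- Two completely contractive homomorphisms from `C(X)` and `C(Y)` into a complete commutative
operator algebra induce one from `C(X × Y)`. -/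
theorem OAlg.exists_ofSpace_prod_hom {C : OAlg.{u}} [CompleteSpace C]
    (hC : ∀ x y : C, x * y = y * x) (f : OAlg.ofSpace X ⟶ C) (g : OAlg.ofSpace Y ⟶ C) :
    ∃ k : OAlg.ofSpace (X × Y) ⟶ C, ∀ t : ProjTensor C(X, ℂ) C(Y, ℂ),
      k.toAlgHom (tensorToProd X Y t) =
        OAlg.tensorLift hC f g t := by
  obtain ⟨k, hk, hkG⟩ := AlgHom.exists_contractive_factor (tensorToProd X Y)
    (OAlg.tensorLift hC f g) (OAlg.norm_lift_le hC f g)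
    (Or.inr ⟨denseRange_tensorToProd, inferInstance⟩)
  refine ⟨⟨k, fun n F => le_of_forall_pos_le_add fun ε hε => ?_⟩, hkG⟩
  -- The `n²` entries together then cost at most `ε / 2`, which is spent twice: on moving from `F`
  -- to `W` and back. The added `1` covers `n = 0`.
  let η : ℝ := ε / (2 * ((n : ℝ) * n + 1))
  have hη : 0 < η := by positivity
  choose t ht using fun i j => denseRange_tensorToProd.exists_dist_lt (F i j) hη
  set W : Matrix (Fin n) (Fin n) C(X × Y, ℂ) := Matrix.map (Matrix.of t) (tensorToProd X Y) with hW
  have hsum : ∑ i, ∑ j, ‖(F - W) i j‖ ≤ ε / 2 := by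
    calc ∑ i, ∑ j, ‖(F - W) i j‖ ≤ ∑ i : Fin n, ∑ j : Fin n, η := by
          refine Finset.sum_le_sum fun i _ => Finset.sum_le_sum fun j _ => ?_
          have := (ht i j).le
          rwa [dist_eq_norm] at this
      _ = n * n * η := by simp [mul_assoc]
      _ ≤ (n * n + 1) * η := by gcongr; linarith
      _ = ε / 2 := by
          simp only [η]
          field_simp
  have h1 : mnorm n (W.map k) ≤ mnorm n W := by
    have h := OAlg.mnorm_lift_le hC f g (Matrix.of t)
    have h2 : W.map k = (Matrix.of t).map
        (OAlg.tensorLift hC f g) := by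
      ext i j
      exact hkG _
    rw [h2]
    exact h
  have h2 : mnorm n (F.map k) ≤ mnorm n (W.map k) + ε / 2 := by
    have h3 : F.map k = W.map k + (F - W).map k := by
      ext i j
      simp
    rw [h3]
    refine (map_add_le_add _ _ _).trans (add_le_add le_rfl ((mnorm_le_sum _).trans ?_))
    exact (Finset.sum_le_sum fun i _ => Finset.sum_le_sum fun j _ => hk _).trans hsum
  have h3 : mnorm n W ≤ mnorm n F + ε / 2 := by
    have h4 : W = F + -(F - W) := by abel
    conv_lhs => rw [h4]
    refine (map_add_le_add _ _ _).trans (add_le_add le_rfl ?_)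
    rw [map_neg_eq_map]
    exact (mnorm_le_sum _).trans hsum
  linarith

end

/-! ### The projective norm and the supremum norm are not equivalent -/

/-- Separated points admit disjointly supported bump functions. -/
theorem exists_bumps {X ι : Type*} [PseudoMetricSpace X] [Fintype ι] [DecidableEq ι] (x : ι → X)
    {r : ℝ} (hr : 0 < r) (hx : ∀ i j, i ≠ j → r ≤ dist (x i) (x j)) :
    ∃ φ : ι → C(X, ℂ), (∀ i j, φ i (x j) = if i = j then 1 else 0) ∧ ∀ z, ∑ i, ‖φ i z‖ ≤ 1 := by
  -- Slope `2 / r` confines each tent to the ball of radius `r / 2`, so tents at `r`-separated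
  -- points are disjoint.
  let w : ι → X → ℝ := fun i z => max 0 (1 - 2 / r * dist z (x i))
  have hw : ∀ i, Continuous (w i) := fun i => by fun_prop
  have hw0 : ∀ i z, 0 ≤ w i z := fun i z => le_max_left _ _
  have hw1 : ∀ i z, w i z ≤ 1 := fun i z => max_le zero_le_one (by
    have : 0 ≤ 2 / r * dist z (x i) := by positivity
    linarith)
  have hlt : ∀ i z, w i z ≠ 0 → dist z (x i) < r / 2 := fun i z h => by
    by_contra! h'
    refine h (max_eq_left ?_)
    have : 2 / r * (r / 2) ≤ 2 / r * dist z (x i) := by gcongr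
    rw [div_mul_div_cancel₀ hr.ne', div_self two_ne_zero] at this
    linarith
  have huniq : ∀ i j z, w i z ≠ 0 → w j z ≠ 0 → i = j := fun i j z hi hj => by
    by_contra hij
    have h1 := hlt i z hi
    have h2 := hlt j z hj
    have h3 := dist_triangle_left (x i) (x j) z
    have h4 := hx i j hij
    linarith
  have hself : ∀ i, w i (x i) = 1 := fun i => by simp [w]
  refine ⟨fun i => ⟨fun z => (w i z : ℂ), Complex.continuous_ofReal.comp (hw i)⟩,
    fun i j => ?_, fun z => ?_⟩
  · simp only [ContinuousMap.coe_mk]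
    split_ifs with h
    · rw [h, hself, Complex.ofReal_one]
    · rw [Complex.ofReal_eq_zero]
      by_contra h'
      exact h (huniq i j (x j) h' (by rw [hself]; exact one_ne_zero))
  · simp only [ContinuousMap.coe_mk, Complex.norm_real, Real.norm_eq_abs, abs_of_nonneg (hw0 _ z)]
    by_cases h : ∃ i, w i z ≠ 0
    · obtain ⟨i, hi⟩ := h
      rw [Finset.sum_eq_single i (fun j _ hji => by
        by_contra hj
        exact hji (huniq j i z hj hi)) (by simp)]
      exact hw1 i z
    · push Not at h
      simp [h]

open ZMod in
/-- Parseval's identity for the Fourier matrix. -/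
theorem sum_norm_sq_fourier {n : ℕ} [NeZero n] (b : ZMod n → ℂ) :
    ∑ i, ‖∑ j, stdAddChar (-(i * j)) * b j‖ ^ 2 = n * ∑ j, ‖b j‖ ^ 2 := by
  have hconj : ∀ x : ZMod n, star (stdAddChar (-x)) = stdAddChar x := fun x => by
    have := AddChar.map_neg_eq_conj (stdAddChar (N := n)) (-x)
    rw [neg_neg] at this
    exact this.symm
  have key : (∑ i, (∑ j, stdAddChar (-(i * j)) * b j) * star (∑ j, stdAddChar (-(i * j)) * b j)) =
      n * ∑ j, b j * star (b j) := by
    calc _ = ∑ i, ∑ j, ∑ k, b j * star (b k) * stdAddChar (i * (k - j)) := by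
          refine Finset.sum_congr rfl fun i _ => ?_
          rw [star_sum, Finset.sum_mul_sum]
          refine Finset.sum_congr rfl fun j _ => Finset.sum_congr rfl fun k _ => ?_
          rw [star_mul', hconj, mul_sub, sub_eq_add_neg, AddChar.map_add_eq_mul]
          ring
      _ = ∑ j, ∑ k, b j * star (b k) * ∑ i, stdAddChar (i * (k - j)) := by
          rw [Finset.sum_comm]
          refine Finset.sum_congr rfl fun j _ => ?_
          rw [Finset.sum_comm]
          simp only [Finset.mul_sum]
      _ = _ := by
          -- Orthogonality of characters leaves only the terms with `k = j`.
          simp only [AddChar.sum_mulShift _ (isPrimitive_stdAddChar n), sub_eq_zero]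
          rw [Finset.mul_sum]
          refine Finset.sum_congr rfl fun j _ => ?_
          rw [Finset.sum_eq_single j (fun k _ hk => by simp [hk]) (by simp)]
          simp only [if_true, ZMod.card]
          ring
  have hsq : ∀ c : ℂ, c * star c = ((‖c‖ ^ 2 : ℝ) : ℂ) := fun c => by
    have := Complex.mul_conj c
    rw [Complex.normSq_eq_norm_sq] at this
    exact this
  simp only [hsq] at key
  exact_mod_cast key

-- The Fourier matrix multiplies `ℓ²` norms by `√n`, and the two vectors have `ℓ²` norms at most `√n
-- α` and `√n β`. Cauchy–Schwarz thus gives `n √n` in place of the trivial `n²`.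
open ZMod in
theorem norm_fourier_form_le {n : ℕ} [NeZero n] (a b : ZMod n → ℂ) {α β : ℝ} (hα : 0 ≤ α)
    (hβ : 0 ≤ β) (ha : ∀ i, ‖a i‖ ≤ α) (hb : ∀ i, ‖b i‖ ≤ β) :
    ‖∑ i, ∑ j, stdAddChar (-(i * j)) * (a i * b j)‖ ≤ n * √n * (α * β) := by
  have h1 : ∑ i, ∑ j, stdAddChar (-(i * j)) * (a i * b j) =
      ∑ i, a i * ∑ j, stdAddChar (-(i * j)) * b j := by
    refine Finset.sum_congr rfl fun i _ => ?_
    rw [Finset.mul_sum]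
    exact Finset.sum_congr rfl fun j _ => by ring
  have hsum : ∀ (c : ZMod n → ℂ) (γ : ℝ), 0 ≤ γ → (∀ i, ‖c i‖ ≤ γ) →
      ∑ i, ‖c i‖ ^ 2 ≤ n * γ ^ 2 := fun c γ hγ hc => by
    calc ∑ i, ‖c i‖ ^ 2 ≤ ∑ i : ZMod n, γ ^ 2 := by
          gcongr with i
          exact hc i
      _ = n * γ ^ 2 := by simp [ZMod.card]
  rw [h1]
  refine le_of_sq_le_sq ?_ (by positivity)
  calc ‖∑ i, a i * ∑ j, stdAddChar (-(i * j)) * b j‖ ^ 2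
      ≤ (∑ i, ‖a i‖ * ‖∑ j, stdAddChar (-(i * j)) * b j‖) ^ 2 := by
        gcongr
        refine (norm_sum_le _ _).trans_eq (Finset.sum_congr rfl fun i _ => norm_mul _ _)
    _ ≤ (∑ i, ‖a i‖ ^ 2) * ∑ i, ‖∑ j, stdAddChar (-(i * j)) * b j‖ ^ 2 :=
        Finset.sum_mul_sq_le_sq_mul_sq _ _ _
    _ ≤ (n * α ^ 2) * (n * (n * β ^ 2)) := by
        rw [sum_norm_sq_fourier]
        gcongr
        · exact hsum a α hα ha
        · exact hsum b β hβ hb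
    _ = (n * √n * (α * β)) ^ 2 := by
        rw [mul_pow, mul_pow, Real.sq_sqrt (Nat.cast_nonneg n)]
        ring

open ZMod in
/-- On a space with `n` separated points there is a tensor of supremum norm at most `1` on which a
functional of norm `n√n` in the projective norm takes the value `n²`. -/
theorem exists_tensor_functional {X : Type u} [PseudoMetricSpace X] [CompactSpace X] {n : ℕ}
    [NeZero n] (x : ZMod n → X) {r : ℝ} (hr : 0 < r)
    (hx : ∀ i j, i ≠ j → r ≤ dist (x i) (x j)) :
    ∃ (t : ProjTensor C(X, ℂ) C(X, ℂ)) (L : C(X × X, ℂ) →L[ℂ] ℂ), ‖tensorToProd X X t‖ ≤ 1 ∧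
      L (tensorToProd X X t) = (n : ℂ) ^ 2 ∧
      ∀ s, ‖L (tensorToProd X X s)‖ ≤ n * √n * ‖s‖ := by
  obtain ⟨φ, hφ, hφ1⟩ := exists_bumps x hr hx
  -- Unimodular coefficients on disjoint bumps keep the supremum norm at most `1`.
  let t : ProjTensor C(X, ℂ) C(X, ℂ) :=
    ∑ i, ∑ j, (stdAddChar (i * j) : ℂ) • ProjTensor.tmul (φ i) (φ j)
  have ht : ∀ z, tensorToProd X X t z = ∑ i, ∑ j, stdAddChar (i * j) * (φ i z.1 * φ j z.2) := by
    intro z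
    simp only [t, map_sum, _root_.map_smul, tensorToProd_tmul, ContinuousMap.sum_apply,
      ContinuousMap.smul_apply, smul_eq_mul, ContinuousMap.mul_apply]
    rfl
  -- The conjugate coefficients make each of the `n²` terms of `L (tensorToProd X X t)` equal to
  -- `1`.
  let L : C(X × X, ℂ) →L[ℂ] ℂ := ∑ i, ∑ j, (stdAddChar (-(i * j)) : ℂ) •
    ContinuousMap.evalCLM ℂ (x i, x j)
  have hL : ∀ F, L F = ∑ i, ∑ j, stdAddChar (-(i * j)) * F (x i, x j) := fun F => by
    simp [L]
  refine ⟨t, L, (ContinuousMap.norm_le _ zero_le_one).2 fun z => ?_, ?_, fun s => ?_⟩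
  · rw [ht]
    calc ‖∑ i, ∑ j, stdAddChar (i * j) * (φ i z.1 * φ j z.2)‖
        ≤ ∑ i, ∑ j, ‖φ i z.1‖ * ‖φ j z.2‖ := by
          refine (norm_sum_le _ _).trans (Finset.sum_le_sum fun i _ =>
            (norm_sum_le _ _).trans (Finset.sum_le_sum fun j _ => ?_))
          rw [norm_mul, norm_mul, AddChar.norm_apply, one_mul]
      _ = (∑ i, ‖φ i z.1‖) * ∑ j, ‖φ j z.2‖ := (Finset.sum_mul_sum _ _ _ _).symm
      _ ≤ 1 := mul_le_one₀ (hφ1 _) (Finset.sum_nonneg fun _ _ => norm_nonneg _) (hφ1 _)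
  · have h1 : ∀ i j, tensorToProd X X t (x i, x j) = stdAddChar (i * j) := fun i j => by
      rw [ht]
      simp [hφ]
    simp only [hL, h1, ← AddChar.map_add_eq_mul, neg_add_cancel, AddChar.map_zero_eq_one]
    simp [ZMod.card, sq]
  · refine ProjTensor.norm_le_of_tmul (L.toLinearMap.toAddMonoidHom.comp
      (tensorToProd X X : ProjTensor C(X, ℂ) C(X, ℂ) →+ C(X × X, ℂ))) (by positivity)
      (fun a b => ?_) s
    change ‖L (tensorToProd X X (ProjTensor.tmul a b))‖ ≤ _
    rw [hL, tensorToProd_tmul]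
    exact norm_fourier_form_le (fun i => a (x i)) (fun j => b (x j)) (norm_nonneg a)
      (norm_nonneg b) (fun i => a.norm_coe_le_norm _) fun j => b.norm_coe_le_norm _

/-- The points `i / n` on the real axis will do. -/
lemma Disk.exists_separated (n : ℕ) [NeZero n] : ∃ x : ZMod n → Disk.{u}, ∀ i j, i ≠ j →
    1 / (n : ℝ) ≤ dist (x i) (x j) := by
  have hn : (0 : ℝ) < n := Nat.cast_pos.2 (NeZero.pos n)
  refine ⟨fun i => ⟨⟨((i.val / n : ℝ) : ℂ), ?_⟩⟩, fun i j hij => ?_⟩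
  · rw [mem_closedBall_zero_iff, Complex.norm_real, Real.norm_of_nonneg (by positivity),
      div_le_one hn]
    exact_mod_cast (ZMod.val_lt i).le
  · have h1 : (i.val : ℤ) - j.val ≠ 0 := fun h => hij (ZMod.val_injective n (by omega))
    have h2 : (1 : ℝ) ≤ |(i.val : ℝ) - j.val| := by exact_mod_cast Int.one_le_abs h1
    change _ ≤ dist (((i.val / n : ℝ) : ℂ)) ((j.val / n : ℝ) : ℂ)
    rw [Complex.dist_eq, ← Complex.ofReal_sub, Complex.norm_real, Real.norm_eq_abs, ← sub_div,
      abs_div, abs_of_pos hn]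
    gcongr

theorem Disk.exists_tensor_functional (n : ℕ) [NeZero n] :
    ∃ (t : ProjTensor C(Disk.{u}, ℂ) C(Disk.{u}, ℂ)) (L : C(Disk.{u} × Disk.{u}, ℂ) →L[ℂ] ℂ),
      ‖tensorToProd Disk.{u} Disk.{u} t‖ ≤ 1 ∧
      L (tensorToProd Disk.{u} Disk.{u} t) = (n : ℂ) ^ 2 ∧
      ∀ s, ‖L (tensorToProd Disk.{u} Disk.{u} s)‖ ≤ n * √n * ‖s‖ := by
  obtain ⟨x, hx⟩ := Disk.exists_separated.{u} n
  exact _root_.exists_tensor_functional x (one_div_pos.2 (Nat.cast_pos.2 (NeZero.pos n))) hx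

/-! ### The completed projective tensor product -/

section

open UniformSpace

namespace ProjTensor

variable (A B : Type u) [NormedCommRing A] [NormedAlgebra ℂ A] [NormedCommRing B]
  [NormedAlgebra ℂ B]

/-- The map from the tensor product to its completion. -/
noncomputable def toCompletion : ProjTensor A B →ₐ[ℂ] Completion (ProjTensor A B) :=
  { (Completion.coeRingHom : ProjTensor A B →+* Completion (ProjTensor A B)) with
    commutes' := fun _ => rfl }

variable {A B}

lemma norm_toCompletion (t : ProjTensor A B) : ‖toCompletion A B t‖ = ‖t‖ := Completion.norm_coe t

lemma tmul_mul_tmul (a a' : A) (b b' : B) : tmul a b * tmul a' b' = tmul (a * a') (b * b') :=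
  Algebra.TensorProduct.tmul_mul_tmul a a' b b'

variable (A B) in
/-- The homomorphism `a ↦ a ⊗ 1`. -/
noncomputable def includeLeft : A →ₐ[ℂ] ProjTensor A B :=
  (Algebra.TensorProduct.includeLeft : A →ₐ[ℂ] A ⊗[ℂ] B)

variable (A B) in
/-- The homomorphism `b ↦ 1 ⊗ b`. -/
noncomputable def includeRight : B →ₐ[ℂ] ProjTensor A B :=
  (Algebra.TensorProduct.includeRight : B →ₐ[ℂ] A ⊗[ℂ] B)

lemma norm_tmul_le (a : A) (b : B) : ‖tmul a b‖ ≤ ‖a‖ * ‖b‖ := projNorm_le (costs_tmul a b)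

lemma algHom_ext {C : Type*} [Ring C] [Algebra ℂ C] {k k' : ProjTensor A B →ₐ[ℂ] C}
    (hl : ∀ a, k (tmul a 1) = k' (tmul a 1)) (hr : ∀ b, k (tmul 1 b) = k' (tmul 1 b)) :
    k = k' := by
  refine AlgHom.ext fun t => ?_
  induction t using induction_on with
  | htmul a b =>
    have : tmul a b = tmul a 1 * tmul 1 b := by rw [tmul_mul_tmul, mul_one, one_mul]
    rw [this, map_mul, map_mul, hl, hr]
  | hadd s t hs ht => rw [map_add, map_add, hs, ht]

end ProjTensor

variable {A B : Type u} [NormedCommRing A] [NormedAlgebra ℂ A] [NormOneClass A]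
  [NormedCommRing B] [NormedAlgebra ℂ B] [NormOneClass B]

theorem NAlg.Hom.eq_of_denseRange {S : Type*} [Ring S] [Algebra ℂ S] {E N : NAlg.{u}}
    {Φ : S →ₐ[ℂ] E} (hΦ : DenseRange Φ) {k k' : E ⟶ N}
    (h : k.toAlgHom.comp Φ = k'.toAlgHom.comp Φ) : k = k' :=
  NAlg.Hom.eq_of_forall fun x => congrFun (hΦ.equalizer (NAlg.Hom.continuous k)
    (NAlg.Hom.continuous k') (funext fun s => DFunLike.congr_fun h s)) x

/-- Commuting contractive homomorphisms extend to the completed projective tensor product. -/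
theorem BanAlg.exists_projTensor_hom {N : BanAlg.{u}} (f : A →ₐ[ℂ] N.obj) (g : B →ₐ[ℂ] N.obj)
    (h : ∀ a b, Commute (f a) (g b)) (hf : ∀ a, ‖f a‖ ≤ ‖a‖) (hg : ∀ b, ‖g b‖ ≤ ‖b‖) :
    ∃ k : BanAlg.projTensor A B ⟶ N, ∀ t : ProjTensor A B,
      BanAlg.fn k (t : Completion (ProjTensor A B)) = ProjTensor.lift f g h t := by
  have : CompleteSpace N.obj := N.property
  obtain ⟨k, hk, hkt⟩ := AlgHom.exists_contractive_factor (ProjTensor.toCompletion A B)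
    (ProjTensor.lift f g h)
    (fun t => (ProjTensor.norm_lift_le f g h hf hg t).trans_eq (ProjTensor.norm_toCompletion t).symm)
    (Or.inr ⟨Completion.denseRange_coe, inferInstance⟩)
  exact ⟨ObjectProperty.homMk ⟨k, hk⟩, hkt⟩

theorem BanAlg.projTensor_hom_ext {N : BanAlg.{u}} {k k' : BanAlg.projTensor A B ⟶ N}
    (hl : ∀ a : A, BanAlg.fn k (ProjTensor.tmul a 1 : ProjTensor A B) =
      BanAlg.fn k' (ProjTensor.tmul a 1 : ProjTensor A B))
    (hr : ∀ b : B, BanAlg.fn k (ProjTensor.tmul 1 b : ProjTensor A B) =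
      BanAlg.fn k' (ProjTensor.tmul 1 b : ProjTensor A B)) : k = k' :=
  ObjectProperty.hom_ext _ (NAlg.Hom.eq_of_denseRange (Φ := ProjTensor.toCompletion A B)
    Completion.denseRange_coe (ProjTensor.algHom_ext hl hr))

/-- The map `a ↦ a ⊗ 1` into the completed projective tensor product. -/
noncomputable def NAlg.projInl (A B : Type u) [NormedCommRing A] [NormedAlgebra ℂ A]
    [NormOneClass A] [NormedCommRing B] [NormedAlgebra ℂ B] [NormOneClass B] :
    NAlg.mk A ⟶ (BanAlg.projTensor A B).obj :=
  ⟨(ProjTensor.toCompletion A B).comp (ProjTensor.includeLeft A B), fun a =>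
    (ProjTensor.norm_toCompletion _).trans_le
      ((ProjTensor.norm_tmul_le a 1).trans_eq (by rw [norm_one, mul_one]))⟩

/-- The map `b ↦ 1 ⊗ b` into the completed projective tensor product. -/
noncomputable def NAlg.projInr (A B : Type u) [NormedCommRing A] [NormedAlgebra ℂ A]
    [NormOneClass A] [NormedCommRing B] [NormedAlgebra ℂ B] [NormOneClass B] :
    NAlg.mk B ⟶ (BanAlg.projTensor A B).obj :=
  ⟨(ProjTensor.toCompletion A B).comp (ProjTensor.includeRight A B), fun b =>
    (ProjTensor.norm_toCompletion _).trans_le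
      ((ProjTensor.norm_tmul_le 1 b).trans_eq (by rw [norm_one, one_mul]))⟩

lemma BanAlg.projTensor_mul_comm (x y : (BanAlg.projTensor A B).obj) : x * y = y * x :=
  mul_comm (G := Completion (ProjTensor A B)) x y

end

/-! ### Abelianizations of coproducts -/

section

open UniformSpace OperatorSpace

lemma BanAlg.fn_congr {A B : BanAlg.{u}} {f g : A ⟶ B} (h : f = g) (x : A.obj) :
    BanAlg.fn f x = BanAlg.fn g x := h ▸ rfl

lemma COAlg.fn_congr {A B : COAlg.{u}} {f g : A ⟶ B} (h : f = g) (x : A.obj) :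
    COAlg.fn f x = COAlg.fn g x := h ▸ rfl

lemma BanAlg.hom_ext_fn {A B : BanAlg.{u}} {f g : A ⟶ B} (h : ∀ x, BanAlg.fn f x = BanAlg.fn g x) :
    f = g :=
  ObjectProperty.hom_ext _ (NAlg.Hom.eq_of_forall h)

lemma COAlg.hom_ext_fn {A B : COAlg.{u}} {f g : A ⟶ B} (h : ∀ x, COAlg.fn f x = COAlg.fn g x) :
    f = g :=
  ObjectProperty.hom_ext _ (OAlg.Hom.eq_of_forall h)

variable (X Y : Type u) [PseudoMetricSpace X] [CompactSpace X] [Nonempty X]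
  [PseudoMetricSpace Y] [CompactSpace Y] [Nonempty Y]

/-- `C(X)` as a Banach algebra. -/
noncomputable abbrev BanAlg.ofSpace : BanAlg.{u} :=
  COAlg.forgetToBanAlg.obj (COAlg.ofSpace X)

/-- The map `f ↦ f ⊗ 1`. -/
noncomputable def BanAlg.tensorInl :
    BanAlg.ofSpace X ⟶ BanAlg.projTensor C(X, ℂ) C(Y, ℂ) :=
  ObjectProperty.homMk (NAlg.projInl C(X, ℂ) C(Y, ℂ))

/-- The map `f ↦ 1 ⊗ f`. -/
noncomputable def BanAlg.tensorInr :
    BanAlg.ofSpace Y ⟶ BanAlg.projTensor C(X, ℂ) C(Y, ℂ) :=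
  ObjectProperty.homMk (NAlg.projInr C(X, ℂ) C(Y, ℂ))

variable {X Y} in
/-- Composition with a continuous map is completely contractive. -/
noncomputable def OAlg.compHom (φ : C(X, Y)) : OAlg.ofSpace Y ⟶ OAlg.ofSpace X :=
  ⟨ContinuousMap.compRightAlgHom ℂ ℂ φ, fun n a =>
    supMatrixNorm_le X n _ (supMatrixNorm_nonneg Y n a) fun x => le_supMatrixNorm Y n a (φ x)⟩

/-- Composition with the first projection. -/
noncomputable def COAlg.prodInl : COAlg.ofSpace X ⟶ COAlg.ofSpace (X × Y) :=
  ObjectProperty.homMk (OAlg.compHom ContinuousMap.fst)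

/-- Composition with the second projection. -/
noncomputable def COAlg.prodInr : COAlg.ofSpace Y ⟶ COAlg.ofSpace (X × Y) :=
  ObjectProperty.homMk (OAlg.compHom ContinuousMap.snd)

variable {X Y}

/-- Maps from the coproduct are pairs of maps. Into a commutative target their images commute, which
is all the projective tensor product requires. -/
theorem BanAlg.isAbelianization_tensor
    [HasBinaryCoproduct (BanAlg.ofSpace X) (BanAlg.ofSpace Y)] :
    BanAlg.IsAbelianization (coprod.desc (BanAlg.tensorInl X Y) (BanAlg.tensorInr X Y)) := by
  refine ⟨BanAlg.projTensor_mul_comm, fun Z hZ h => ?_⟩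
  let f : BanAlg.ofSpace X ⟶ Z := coprod.inl ≫ h
  let g : BanAlg.ofSpace Y ⟶ Z := coprod.inr ≫ h
  let f' : C(X, ℂ) →ₐ[ℂ] Z.obj := f.hom.toAlgHom
  let g' : C(Y, ℂ) →ₐ[ℂ] Z.obj := g.hom.toAlgHom
  obtain ⟨k, hk⟩ := BanAlg.exists_projTensor_hom f' g' (fun _ _ => hZ _ _) f.hom.contractive g.hom.contractive
  have hkl : BanAlg.tensorInl X Y ≫ k = f := BanAlg.hom_ext_fn fun a => by
    refine (hk (ProjTensor.tmul a 1)).trans ((ProjTensor.lift_tmul f' g' _ a 1).trans ?_)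
    rw [map_one, mul_one]
    rfl
  have hkr : BanAlg.tensorInr X Y ≫ k = g := BanAlg.hom_ext_fn fun b => by
    refine (hk (ProjTensor.tmul 1 b)).trans ((ProjTensor.lift_tmul f' g' _ 1 b).trans ?_)
    rw [map_one, one_mul]
    rfl
  refine ⟨k, coprod.hom_ext ?_ ?_, fun m hm => ?_⟩
  · rw [coprod.inl_desc_assoc, hkl]
  · rw [coprod.inr_desc_assoc, hkr]
  · have hml : BanAlg.tensorInl X Y ≫ m = f := by
      rw [← coprod.inl_desc_assoc (BanAlg.tensorInl X Y) (BanAlg.tensorInr X Y) m, hm]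
    have hmr : BanAlg.tensorInr X Y ≫ m = g := by
      rw [← coprod.inr_desc_assoc (BanAlg.tensorInl X Y) (BanAlg.tensorInr X Y) m, hm]
    exact BanAlg.projTensor_hom_ext (fun a => BanAlg.fn_congr (hml.trans hkl.symm) a)
      fun b => BanAlg.fn_congr (hmr.trans hkr.symm) b

/-- Homomorphisms on `C(X × Y)` are determined by their values on `C(X)` and `C(Y)`. -/
theorem BanAlg.prod_hom_ext {N : BanAlg.{u}}
    {k k' : COAlg.forgetToBanAlg.obj (COAlg.ofSpace (X × Y)) ⟶ N}
    (hl : COAlg.forgetToBanAlg.map (COAlg.prodInl X Y) ≫ k =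
      COAlg.forgetToBanAlg.map (COAlg.prodInl X Y) ≫ k')
    (hr : COAlg.forgetToBanAlg.map (COAlg.prodInr X Y) ≫ k =
      COAlg.forgetToBanAlg.map (COAlg.prodInr X Y) ≫ k') : k = k' := by
  refine ObjectProperty.hom_ext _ (NAlg.Hom.eq_of_denseRange (Φ := tensorToProd X Y)
    denseRange_tensorToProd (ProjTensor.algHom_ext (fun a => ?_) fun b => ?_))
  · have h : tensorToProd X Y (ProjTensor.tmul a 1) = a.comp ContinuousMap.fst :=
      (tensorToProd_tmul a 1).trans (mul_one _)
    change BanAlg.fn k (tensorToProd X Y _) = BanAlg.fn k' (tensorToProd X Y _)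
    rw [h]
    exact BanAlg.fn_congr hl a
  · have h : tensorToProd X Y (ProjTensor.tmul 1 b) = b.comp ContinuousMap.snd :=
      (tensorToProd_tmul 1 b).trans (one_mul _)
    change BanAlg.fn k (tensorToProd X Y _) = BanAlg.fn k' (tensorToProd X Y _)
    rw [h]
    exact BanAlg.fn_congr hr b

section

variable [HasBinaryCoproduct (COAlg.ofSpace X) (COAlg.ofSpace Y)]

variable (X Y) in
/-- The map from the coproduct of `C(X)` and `C(Y)` to `C(X × Y)`. -/
noncomputable def COAlg.coprodToProd :
    COAlg.ofSpace X ⨿ COAlg.ofSpace Y ⟶ COAlg.ofSpace (X × Y) :=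
  coprod.desc (COAlg.prodInl X Y) (COAlg.prodInr X Y)

theorem COAlg.exists_desc_of_comm {Z : COAlg.{u}} (hZ : ∀ x y : Z.obj, x * y = y * x)
    (h : COAlg.ofSpace X ⨿ COAlg.ofSpace Y ⟶ Z) :
    ∃ k : COAlg.ofSpace (X × Y) ⟶ Z, COAlg.coprodToProd X Y ≫ k = h := by
  have : CompleteSpace Z.obj := Z.property
  let f : COAlg.ofSpace X ⟶ Z := coprod.inl ≫ h
  let g : COAlg.ofSpace Y ⟶ Z := coprod.inr ≫ h
  obtain ⟨k, hk⟩ := OAlg.exists_ofSpace_prod_hom hZ f.hom g.hom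
  have hkt : ∀ a b, k.toAlgHom (a.comp ContinuousMap.fst * b.comp ContinuousMap.snd) =
      f.hom.toAlgHom a * g.hom.toAlgHom b := fun a b => by
    rw [← tensorToProd_tmul, hk, OAlg.tensorLift_tmul]
  refine ⟨ObjectProperty.homMk k, coprod.hom_ext ?_ ?_⟩
  · rw [COAlg.coprodToProd, coprod.inl_desc_assoc]
    refine COAlg.hom_ext_fn fun a => ?_
    have h1 := hkt a 1
    rw [map_one, mul_one] at h1
    exact (congrArg k.toAlgHom (mul_one (a.comp ContinuousMap.fst)).symm).trans h1
  · rw [COAlg.coprodToProd, coprod.inr_desc_assoc]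
    refine COAlg.hom_ext_fn fun b => ?_
    have h1 := hkt 1 b
    rw [map_one, one_mul] at h1
    exact (congrArg k.toAlgHom (one_mul (b.comp ContinuousMap.snd)).symm).trans h1

/-- The two copies generate a dense subalgebra of `C(X × Y)`, so the map stays epi after the matrix
norms are forgotten. -/
lemma COAlg.map_coprodToProd_cancel {N : BanAlg.{u}}
    {k k' : COAlg.forgetToBanAlg.obj (COAlg.ofSpace (X × Y)) ⟶ N}
    (h : COAlg.forgetToBanAlg.map (COAlg.coprodToProd X Y) ≫ k =
      COAlg.forgetToBanAlg.map (COAlg.coprodToProd X Y) ≫ k') : k = k' := by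
  refine BanAlg.prod_hom_ext ?_ ?_
  · rw [← coprod.inl_desc (COAlg.prodInl X Y) (COAlg.prodInr X Y), Functor.map_comp,
      Category.assoc, Category.assoc]
    exact congrArg _ h
  · rw [← coprod.inr_desc (COAlg.prodInl X Y) (COAlg.prodInr X Y), Functor.map_comp,
      Category.assoc, Category.assoc]
    exact congrArg _ h

lemma COAlg.coprodToProd_cancel {N : COAlg.{u}} {k k' : COAlg.ofSpace (X × Y) ⟶ N}
    (h : COAlg.coprodToProd X Y ≫ k = COAlg.coprodToProd X Y ≫ k') : k = k' := by
  refine COAlg.forgetToBanAlg.map_injective (COAlg.map_coprodToProd_cancel ?_)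
  rw [← Functor.map_comp, ← Functor.map_comp, h]

theorem COAlg.isAbelianization_coprodToProd : COAlg.IsAbelianization (COAlg.coprodToProd X Y) := by
  refine ⟨fun x y => mul_comm (G := C(X × Y, ℂ)) x y, fun Z hZ h => ?_⟩
  obtain ⟨k, hk⟩ := COAlg.exists_desc_of_comm hZ h
  exact ⟨k, hk, fun m hm => COAlg.coprodToProd_cancel (hm.trans hk.symm)⟩

/-- A commutative Banach algebra carries no matrix norms, but a map to it factors through the
quotient by the kernel. That quotient is a complete operator algebra, commutative because it embeds
in the target, so the universal property among operator algebras applies. -/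
theorem BanAlg.isAbelianization_coprodToProd :
    BanAlg.IsAbelianization (COAlg.forgetToBanAlg.map (COAlg.coprodToProd X Y)) := by
  refine ⟨fun x y => mul_comm (G := C(X × Y, ℂ)) x y, fun Z hZ h => ?_⟩
  obtain ⟨Q, p, j, hpj, hj, -⟩ := COAlg.exists_quotient_ker h
  have hQ : ∀ x y : Q.obj, x * y = y * x := fun x y => hj (by
    change j.hom.toAlgHom (x * y) = j.hom.toAlgHom (y * x)
    exact (map_mul j.hom.toAlgHom x y).trans ((hZ _ _).trans (map_mul j.hom.toAlgHom y x).symm))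
  obtain ⟨k, hk⟩ := COAlg.exists_desc_of_comm hQ p
  have hk' : COAlg.forgetToBanAlg.map (COAlg.coprodToProd X Y) ≫ COAlg.forgetToBanAlg.map k ≫ j =
      h := by
    rw [← Category.assoc, ← Functor.map_comp, hk, hpj]
  exact ⟨_, hk', fun m hm => COAlg.map_coprodToProd_cancel (hm.trans hk'.symm)⟩

/-- The quotient by the kernel is a commutative operator algebra, so universality gives a map to it
from `C(X × Y)`. This is a section of the inclusion of the quotient, which is therefore onto. -/
theorem COAlg.coprodToProd_surjective : Function.Surjective (COAlg.fn (COAlg.coprodToProd X Y)) := by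
  obtain ⟨Q, p, j, hpj, hj, hp⟩ := COAlg.exists_factor_ker (COAlg.coprodToProd X Y)
  have hQ : ∀ x y : Q.obj, x * y = y * x := fun x y => hj (by
    change j.hom.toAlgHom (x * y) = j.hom.toAlgHom (y * x)
    rw [map_mul, map_mul]
    exact mul_comm (G := C(X × Y, ℂ)) _ _)
  obtain ⟨k, hk⟩ := COAlg.exists_desc_of_comm hQ p
  have hkj : k ≫ j = 𝟙 _ := COAlg.coprodToProd_cancel (by
    rw [← Category.assoc, hk, hpj, Category.comp_id])
  intro F
  obtain ⟨x, hx⟩ := hp (COAlg.fn k F)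
  refine ⟨x, ?_⟩
  have h1 : COAlg.fn (COAlg.coprodToProd X Y) x = COAlg.fn j (COAlg.fn p x) :=
    (COAlg.fn_congr hpj x).symm
  rw [h1, hx]
  exact COAlg.fn_congr hkj F

end

/-! ### Failure of surjectivity and of preservation -/

variable (X Y) in
/-- The canonical map from the completed projective tensor product to `C(X × Y)`. -/
theorem BanAlg.exists_tensorToProd :
    ∃ κ : BanAlg.projTensor C(X, ℂ) C(Y, ℂ) ⟶ COAlg.forgetToBanAlg.obj (COAlg.ofSpace (X × Y)),
      ∀ t : ProjTensor C(X, ℂ) C(Y, ℂ),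
        BanAlg.fn κ (t : Completion (ProjTensor C(X, ℂ) C(Y, ℂ))) = tensorToProd X Y t :=
  BanAlg.exists_projTensor_hom (N := COAlg.forgetToBanAlg.obj (COAlg.ofSpace (X × Y)))
    (ContinuousMap.compRightAlgHom ℂ ℂ ContinuousMap.fst)
    (ContinuousMap.compRightAlgHom ℂ ℂ ContinuousMap.snd) (fun _ _ => mul_comm (G := C(X × Y, ℂ)) _ _)
    norm_comp_fst_le norm_comp_snd_le

/-- The open mapping theorem would bound the norms of preimages by a constant `C` times the supremum
norm, and the Fourier tensors would give `n² ≤ n √n C` for every positive `n`. -/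
theorem BanAlg.tensorToProd_not_surjective
    (κ : BanAlg.projTensor C(Disk.{u}, ℂ) C(Disk.{u}, ℂ) ⟶
      COAlg.forgetToBanAlg.obj (COAlg.ofSpace (Disk.{u} × Disk.{u})))
    (hκ : ∀ t : ProjTensor C(Disk.{u}, ℂ) C(Disk.{u}, ℂ),
      BanAlg.fn κ (t : Completion (ProjTensor C(Disk.{u}, ℂ) C(Disk.{u}, ℂ))) =
        tensorToProd Disk.{u} Disk.{u} t) : ¬ Function.Surjective (BanAlg.fn κ) := by
  intro hs
  let k : Completion (ProjTensor C(Disk.{u}, ℂ) C(Disk.{u}, ℂ)) →L[ℂ]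
      C(Disk.{u} × Disk.{u}, ℂ) :=
    κ.hom.toAlgHom.toLinearMap.mkContinuous 1 fun x => by
      rw [one_mul]; exact κ.hom.contractive x
  obtain ⟨C, hC, hk⟩ := k.exists_preimage_norm_le hs
  -- The inequality forces `n ≤ C ^ 2`; taking `n = m + 1` makes `n` visibly nonzero.
  obtain ⟨m, hm⟩ := exists_nat_gt (C ^ 2)
  let n := m + 1
  have hn : (0 : ℝ) < n := by positivity
  obtain ⟨t, L, ht, hLt, hL⟩ := Disk.exists_tensor_functional.{u} n
  obtain ⟨s, hs, hsn⟩ := hk (tensorToProd Disk.{u} Disk.{u} t)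
  -- The bound on algebraic tensors passes to the completion by density, as preimages need not be
  -- algebraic.
  have hLk : ∀ s, ‖L (k s)‖ ≤ n * √n * ‖s‖ := fun s => by
    induction s using Completion.induction_on with
    | hp => exact isClosed_le (by fun_prop) (by fun_prop)
    | ih s =>
      rw [Completion.norm_coe]
      exact (congrArg (fun F => ‖L F‖) (hκ s)).trans_le (hL s)
  replace hLk := hLk s
  rw [hs, hLt, norm_pow, Complex.norm_natCast] at hLk
  have h1 : (n : ℝ) ^ 2 ≤ n * √n * C := hLk.trans (by
    gcongr
    exact hsn.trans ((mul_le_mul_of_nonneg_left ht hC.le).trans_eq (mul_one C)))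
  have h2 : √n ≤ C := by
    have h3 : (n : ℝ) * √n * √n ≤ n * √n * C := by
      rwa [mul_assoc, Real.mul_self_sqrt hn.le, ← sq]
    exact le_of_mul_le_mul_left h3 (by positivity)
  have h4 : (n : ℝ) ≤ C ^ 2 := (Real.sqrt_le_left hC.le).1 h2
  have h5 : (n : ℝ) = m + 1 := by simp [n]
  linarith

/-- The forgetful functor does not preserve the coproduct of two copies of `C(Disk)`. -/
theorem OAlg.not_preservesColimit_pair :
    ¬ PreservesColimit (pair (OAlg.ofSpace Disk.{u}) (OAlg.ofSpace Disk.{u}))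
      OAlg.forgetToNAlg.{u} := by
  intro hpres
  have := OAlg.hasBinaryCoproduct_self (OAlg.ofSpace Disk.{u})
  let A := OAlg.ofSpace Disk.{u}
  -- Preservation would extend the two canonical maps into the projective tensor product to the
  -- operator algebra coproduct.
  obtain ⟨h, hl, hr⟩ := BinaryCofan.IsColimit.desc'
    (isColimitOfHasBinaryCoproductOfPreservesColimit OAlg.forgetToNAlg.{u} A A)
    (NAlg.projInl C(Disk.{u}, ℂ) C(Disk.{u}, ℂ)) (NAlg.projInr C(Disk.{u}, ℂ) C(Disk.{u}, ℂ))
  obtain ⟨Q, p, j, hpj, hj, -⟩ := OAlg.exists_quotient_ker h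
  have hQ : ∀ x y : Q, x * y = y * x := fun x y => hj (by
    refine (map_mul j.toAlgHom x y).trans ((BanAlg.projTensor_mul_comm _ _).trans
      (map_mul j.toAlgHom y x).symm))
  let f : A ⟶ Q := coprod.inl ≫ p
  let g : A ⟶ Q := coprod.inr ≫ p
  have hjf : OAlg.forgetToNAlg.map f ≫ j = NAlg.projInl C(Disk.{u}, ℂ) C(Disk.{u}, ℂ) := by
    rw [Functor.map_comp, Category.assoc, hpj]
    exact hl
  have hjg : OAlg.forgetToNAlg.map g ≫ j = NAlg.projInr C(Disk.{u}, ℂ) C(Disk.{u}, ℂ) := by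
    rw [Functor.map_comp, Category.assoc, hpj]
    exact hr
  -- The embedding of the algebraic tensor product, isometric for the projective norm, now passes
  -- through the commutative operator algebra `Q`, where the supremum norm dominates.
  have hjt : j.toAlgHom.comp (OAlg.tensorLift hQ f g) = ProjTensor.toCompletion _ _ := by
    refine ProjTensor.algHom_ext (fun a => ?_) fun b => ?_
    · change j.toAlgHom (OAlg.tensorLift hQ f g _) = _
      rw [OAlg.tensorLift_tmul]
      rw [show g.toAlgHom (1 : C(Disk.{u}, ℂ)) = 1 from map_one _, mul_one]
      exact NAlg.Hom.apply_congr hjf a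
    · change j.toAlgHom (OAlg.tensorLift hQ f g _) = _
      rw [OAlg.tensorLift_tmul]
      rw [show f.toAlgHom (1 : C(Disk.{u}, ℂ)) = 1 from map_one _, one_mul]
      exact NAlg.Hom.apply_congr hjg b
  -- `n = 4` is enough: `4² = 16` exceeds `4 √4 = 8`.
  obtain ⟨t, L, ht, hLt, hL⟩ := Disk.exists_tensor_functional.{u} 4
  have h1 : ‖t‖ ≤ 1 := by
    rw [← ProjTensor.norm_toCompletion, ← hjt]
    exact (j.contractive _).trans ((OAlg.norm_lift_le hQ f g t).trans ht)
  have h2 := hL t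
  have h3 : √(4 : ℝ) = 2 := by
    rw [show (4 : ℝ) = 2 ^ 2 by norm_num]
    exact Real.sqrt_sq zero_le_two
  rw [hLt, norm_pow, Complex.norm_natCast] at h2
  push_cast at h2
  rw [h3] at h2
  linarith

end

lemma coprodComparison_comp_coprodToProd {X Y : Type u} [PseudoMetricSpace X] [CompactSpace X]
    [Nonempty X] [PseudoMetricSpace Y] [CompactSpace Y] [Nonempty Y]
    [HasBinaryCoproduct (COAlg.ofSpace X) (COAlg.ofSpace Y)]
    [HasBinaryCoproduct (BanAlg.ofSpace X) (BanAlg.ofSpace Y)]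
    (κ : BanAlg.projTensor C(X, ℂ) C(Y, ℂ) ⟶ COAlg.forgetToBanAlg.obj (COAlg.ofSpace (X × Y)))
    (hκ : ∀ t : ProjTensor C(X, ℂ) C(Y, ℂ),
      BanAlg.fn κ (t : UniformSpace.Completion (ProjTensor C(X, ℂ) C(Y, ℂ))) =
        tensorToProd X Y t) :
    coprodComparison COAlg.forgetToBanAlg.{u} (COAlg.ofSpace X) (COAlg.ofSpace Y) ≫
        COAlg.forgetToBanAlg.map (COAlg.coprodToProd X Y) =
      coprod.desc (BanAlg.tensorInl X Y) (BanAlg.tensorInr X Y) ≫ κ := by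
  refine coprod.hom_ext ?_ ?_
  · rw [coprodComparison_inl_assoc, coprod.inl_desc_assoc, ← Functor.map_comp,
      COAlg.coprodToProd, coprod.inl_desc]
    exact BanAlg.hom_ext_fn fun a =>
      ((hκ (ProjTensor.tmul a 1)).trans ((tensorToProd_tmul a 1).trans (mul_one _))).symm
  · rw [coprodComparison_inr_assoc, coprod.inr_desc_assoc, ← Functor.map_comp,
      COAlg.coprodToProd, coprod.inr_desc]
    exact BanAlg.hom_ext_fn fun b =>
      ((hκ (ProjTensor.tmul 1 b)).trans ((tensorToProd_tmul 1 b).trans (one_mul _))).symm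

/-- The operator coproduct maps onto `C(Disk × Disk)`, so by the commutative square a surjective
comparison would make `κ` surjective. -/
theorem coprodComparison_not_surjective
    [HasBinaryCoproduct (COAlg.ofSpace Disk.{u}) (COAlg.ofSpace Disk.{u})]
    [HasBinaryCoproduct (BanAlg.ofSpace Disk.{u}) (BanAlg.ofSpace Disk.{u})] :
    ¬ Function.Surjective (BanAlg.fn (coprodComparison COAlg.forgetToBanAlg.{u}
      (COAlg.ofSpace Disk.{u}) (COAlg.ofSpace Disk.{u}))) := by
  obtain ⟨κ, hκ⟩ := BanAlg.exists_tensorToProd Disk.{u} Disk.{u}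
  have hc := coprodComparison_comp_coprodToProd κ hκ
  intro hs
  refine BanAlg.tensorToProd_not_surjective κ hκ fun F => ?_
  obtain ⟨x, rfl⟩ := COAlg.coprodToProd_surjective (X := Disk.{u}) (Y := Disk.{u}) F
  obtain ⟨y, rfl⟩ := hs x
  exact ⟨_, (BanAlg.fn_congr hc y).symm⟩

theorem COAlg.not_preservesColimit_pair :
    ¬ PreservesColimit (pair (COAlg.ofSpace Disk.{u}) (COAlg.ofSpace Disk.{u}))
      COAlg.forgetToBanAlg.{u} := by
  intro hpres
  have := COAlg.hasBinaryCoproduct_self (COAlg.ofSpace Disk.{u})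
  have := BanAlg.hasBinaryCoproduct_self (BanAlg.ofSpace Disk.{u})
  let c := coprodComparison COAlg.forgetToBanAlg.{u} (COAlg.ofSpace Disk.{u})
    (COAlg.ofSpace Disk.{u})
  have hc : IsIso c := inferInstance
  exact coprodComparison_not_surjective.{u} fun x =>
    ⟨BanAlg.fn (inv c) x, BanAlg.fn_congr (IsIso.inv_hom_id c) x⟩

/-! ### The main theorem -/

theorem mainTheorem11 :
    -- operator algebras and normed algebras, not necessarily complete
    (PreservesColimitsOfShape WalkingParallelPair OAlg.forgetToNAlg.{u} ∧
      ¬ PreservesColimitsOfShape (Discrete WalkingPair) OAlg.forgetToNAlg.{u} ∧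
      ¬ PreservesColimit (pair (OAlg.ofSpace Disk.{u}) (OAlg.ofSpace Disk.{u}))
          OAlg.forgetToNAlg.{u} ∧
      ¬ OAlg.forgetToNAlg.{u}.IsLeftAdjoint) ∧
    -- complete operator algebras and Banach algebras
    (PreservesColimitsOfShape WalkingParallelPair COAlg.forgetToBanAlg.{u} ∧
      ¬ PreservesColimitsOfShape (Discrete WalkingPair) COAlg.forgetToBanAlg.{u} ∧
      ¬ PreservesColimit (pair (COAlg.ofSpace Disk.{u}) (COAlg.ofSpace Disk.{u}))
          COAlg.forgetToBanAlg.{u} ∧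
      ¬ COAlg.forgetToBanAlg.{u}.IsLeftAdjoint) ∧
    -- the comparison map for the coproduct of two copies of `C(Disk)`, and its abelianization
    (∃ (_ : HasBinaryCoproduct (COAlg.ofSpace Disk.{u}) (COAlg.ofSpace Disk.{u}))
      (_ : HasBinaryCoproduct (COAlg.forgetToBanAlg.{u}.obj (COAlg.ofSpace Disk.{u}))
        (COAlg.forgetToBanAlg.{u}.obj (COAlg.ofSpace Disk.{u}))),
      ¬ Function.Surjective (BanAlg.fn (coprodComparison COAlg.forgetToBanAlg.{u}
          (COAlg.ofSpace Disk.{u}) (COAlg.ofSpace Disk.{u}))) ∧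
      ∃ (q₁ : COAlg.forgetToBanAlg.{u}.obj (COAlg.ofSpace Disk.{u}) ⨿
            COAlg.forgetToBanAlg.{u}.obj (COAlg.ofSpace Disk.{u}) ⟶
            BanAlg.projTensor C(Disk.{u}, ℂ) C(Disk.{u}, ℂ))
        (q₂ : COAlg.ofSpace Disk.{u} ⨿ COAlg.ofSpace Disk.{u} ⟶
            COAlg.ofSpace (Disk.{u} × Disk.{u}))
        (κ : BanAlg.projTensor C(Disk.{u}, ℂ) C(Disk.{u}, ℂ) ⟶
            COAlg.forgetToBanAlg.{u}.obj (COAlg.ofSpace (Disk.{u} × Disk.{u}))),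
        BanAlg.IsAbelianization q₁ ∧
        (∀ f : C(Disk.{u}, ℂ),
          BanAlg.fn q₁ (BanAlg.fn coprod.inl f) =
              ((ProjTensor.tmul f 1 : ProjTensor C(Disk.{u}, ℂ) C(Disk.{u}, ℂ)) :
                UniformSpace.Completion (ProjTensor C(Disk.{u}, ℂ) C(Disk.{u}, ℂ))) ∧
          BanAlg.fn q₁ (BanAlg.fn coprod.inr f) =
              ((ProjTensor.tmul 1 f : ProjTensor C(Disk.{u}, ℂ) C(Disk.{u}, ℂ)) :
                UniformSpace.Completion (ProjTensor C(Disk.{u}, ℂ) C(Disk.{u}, ℂ)))) ∧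
        COAlg.IsAbelianization q₂ ∧
        BanAlg.IsAbelianization (COAlg.forgetToBanAlg.{u}.map q₂) ∧
        (∀ f : C(Disk.{u}, ℂ),
          COAlg.fn q₂ (COAlg.fn coprod.inl f) = f.comp ContinuousMap.fst ∧
          COAlg.fn q₂ (COAlg.fn coprod.inr f) = f.comp ContinuousMap.snd) ∧
        (∀ f g : C(Disk.{u}, ℂ),
          BanAlg.fn κ ((ProjTensor.tmul f g : ProjTensor C(Disk.{u}, ℂ) C(Disk.{u}, ℂ)) :
              UniformSpace.Completion (ProjTensor C(Disk.{u}, ℂ) C(Disk.{u}, ℂ))) =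
            f.comp ContinuousMap.fst * g.comp ContinuousMap.snd) ∧
        coprodComparison COAlg.forgetToBanAlg.{u} (COAlg.ofSpace Disk.{u})
            (COAlg.ofSpace Disk.{u}) ≫ COAlg.forgetToBanAlg.{u}.map q₂ = q₁ ≫ κ ∧
        ¬ Function.Surjective (BanAlg.fn κ)) := by
  refine ⟨⟨OAlg.preservesCoequalizers_forget, fun h => ?_, OAlg.not_preservesColimit_pair,
    fun h => ?_⟩, ⟨COAlg.preservesCoequalizers_forget, fun h => ?_,
    COAlg.not_preservesColimit_pair, fun h => ?_⟩, ?_⟩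
  · exact OAlg.not_preservesColimit_pair inferInstance
  · have : PreservesColimitsOfSize.{0, 0} OAlg.forgetToNAlg.{u} :=
      (Adjunction.ofIsLeftAdjoint OAlg.forgetToNAlg.{u}).leftAdjoint_preservesColimits
    exact OAlg.not_preservesColimit_pair inferInstance
  · exact COAlg.not_preservesColimit_pair inferInstance
  · have : PreservesColimitsOfSize.{0, 0} COAlg.forgetToBanAlg.{u} :=
      (Adjunction.ofIsLeftAdjoint COAlg.forgetToBanAlg.{u}).leftAdjoint_preservesColimits
    exact COAlg.not_preservesColimit_pair inferInstance
  · have h1 := COAlg.hasBinaryCoproduct_self (COAlg.ofSpace Disk.{u})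
    have h2 := BanAlg.hasBinaryCoproduct_self (BanAlg.ofSpace Disk.{u})
    obtain ⟨κ, hκ⟩ := BanAlg.exists_tensorToProd Disk.{u} Disk.{u}
    refine ⟨h1, h2, coprodComparison_not_surjective,
      coprod.desc (BanAlg.tensorInl Disk Disk) (BanAlg.tensorInr Disk Disk),
      COAlg.coprodToProd Disk Disk, κ, BanAlg.isAbelianization_tensor, fun f => ⟨?_, ?_⟩,
      COAlg.isAbelianization_coprodToProd, BanAlg.isAbelianization_coprodToProd,
      fun f => ⟨?_, ?_⟩, fun f g => (hκ _).trans (tensorToProd_tmul f g),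
      coprodComparison_comp_coprodToProd κ hκ, BanAlg.tensorToProd_not_surjective κ hκ⟩
    · exact BanAlg.fn_congr (coprod.inl_desc (BanAlg.tensorInl Disk Disk)
        (BanAlg.tensorInr Disk Disk)) f
    · exact BanAlg.fn_congr (coprod.inr_desc (BanAlg.tensorInl Disk Disk)
        (BanAlg.tensorInr Disk Disk)) f
    · exact COAlg.fn_congr (coprod.inl_desc (COAlg.prodInl Disk Disk)
        (COAlg.prodInr Disk Disk)) f
    · exact COAlg.fn_congr (coprod.inr_desc (COAlg.prodInl Disk Disk)
        (COAlg.prodInr Disk Disk)) f
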